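/- For $\mu=(\mu_1,\mu_2)\in\mathbb R^2$ let $G_\mu=\tfrac12 N(\mu_1,1)+\tfrac12 N(\mu_2,1)$, and let $d_{TV}(P,Q)=\sup_A\,(P(A)-Q(A))$, the supremum being over measurable $A\subseteq\mathbb R$. A discriminator is a function $D_{\ell,r}=\mathbb 1_{[\ell_1,r_1]}+\mathbb 1_{[\ell_2,r_2]}$ on $\mathbb R$ with $\ell_1\le r_1\le \ell_2\le r_2$ in $[-\infty,\infty]$, so intervals may be infinite. For $\mu^*,\mu\in\mathbb R^2$ put $$L(\mu,\ell,r)=\mathbb E_{x\sim G_{\mu^*}}[D_{\ell,r}(x)]+\mathbb E_{x\sim G_{\mu}}[1-D_{\ell,r}(x)].$$ Given $\mu^*$, a step size $\eta>0$ and perturbations $\xi^{(t)}\in\mathbb R^2$, the optimal discriminator dynamics is $$(\ell^{(t)},r^{(t)})\in\arg\max_{\ell,r}L(\hat\mu^{(t)},\ell,r),\qquad \hat\mu^{(t+1)}=\hat\mu^{(t)}-\eta\,\nabla_\mu L(\hat\mu^{(t)},\ell^{(t)},r^{(t)})+\xi^{(t)},$$ where the gradient is taken with $(\ell^{(t)},r^{(t)})$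 held fixed and any maximizer may be chosen. It is noiseless if $\xi^{(t)}=0$ for all $t$. **Theorem.** There are absolute constants $\delta_0,c,A>0$ and $a,b\in\mathbb N$ such that the following holds for all $0<\delta\le\delta_0$, all $C>0$, every step size $0<\eta\le c\,(\delta e^{-C^2})^a$ and every integer $T\ge A\,(e^{C^2}/\delta)^b/\eta$. (In particular $\eta$ can be taken to be $1/\mathrm{poly}(1/\delta,e^{C^2})$, with $T=\mathrm{poly}(1/\delta,e^{C^2})$.) 1. Let $\mu^*,\hat\mu^{(0)}\in\mathbb R^2$ satisfy $|\mu^*_i|\le C$ and $|\hat\mu^{(0)}_i|\le C$ for $i=1,2$, $|\mu^*_1-\mu^*_2|\ge\delta$ and $|\hat\mu^{(0)}_1-\hat\mu^{(0)}_2|\ge\delta$. Then the noiseless optimal discriminator dynamics can be run from $\hat\mu^{(0)}$, and every such run, whatever maximizers are chosen, satisfies $d_{TV}(G_{\mu^*},G_{\hat\mu^{(T)}})\le\delta$. 2. For every $p>0$ there is $\sigma_0>0$, depending only on $p,\delta,C,\eta,T$, such that for all $0<\sigma\le\sigma_0$ and all $\mu^*,\hat\mu^{(0)}$ as in 1, every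 run from $\hat\mu^{(0)}$ with i.i.d. Gaussian perturbations $\xi^{(t)}\sim N(0,\sigma^2 I_2)$ satisfies $d_{TV}(G_{\mu^*},G_{\hat\mu^{(T)}})\le\delta$ except on an event of (outer) probability at most $p$. -/

import Mathlib

open MeasureTheory ProbabilityTheory
open scoped NNReal ENNReal

namespace GaussGAN

/-- Parameters of the generators: the plane with its Euclidean structure. -/
abbrev Param : Type := EuclideanSpace ℝ (Fin 2)

/-- The generator `G_μ`: the equal-weight mixture of `N(μ₁, 1)` and `N(μ₂, 1)`. -/
noncomputable def mixture (μ : Param) : Measure ℝ :=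
  (2⁻¹ : ℝ≥0∞) • gaussianReal (μ 0) 1 + (2⁻¹ : ℝ≥0∞) • gaussianReal (μ 1) 1

/-- Total variation distance of two probability measures on the line:
`sup_A (P(A) - Q(A))` over all measurable events `A`. -/
noncomputable def tvDist (P Q : Measure ℝ) : ℝ :=
  ⨆ A : {A : Set ℝ // MeasurableSet A}, (P.real A - Q.real A)

/-- Endpoints `(ℓ, r)` of two ordered intervals, with `ℓ₁ ≤ r₁ ≤ ℓ₂ ≤ r₂`. Infinite endpoints are
allowed, so that half-lines count as intervals and the best discriminator exists. -/
def Admissible : Set ((Fin 2 → EReal) × (Fin 2 → EReal)) :=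
  {d | d.1 0 ≤ d.2 0 ∧ d.2 0 ≤ d.1 1 ∧ d.1 1 ≤ d.2 1}

/-- The discriminator `D = 𝟙_[ℓ₁, r₁] + 𝟙_[ℓ₂, r₂]`, a function on the real line. -/
noncomputable def discriminator (d : (Fin 2 → EReal) × (Fin 2 → EReal)) (x : ℝ) : ℝ :=
  ∑ i : Fin 2, Set.indicator {y : ℝ | d.1 i ≤ (y : EReal) ∧ (y : EReal) ≤ d.2 i} (fun _ => (1 : ℝ)) x

/-- The objective `L(μ, ℓ, r) = E_{x ∼ G_{μ*}} [D(x)] + E_{x ∼ G_μ} [1 - D(x)]`. -/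
noncomputable def loss (μs μ : Param) (d : (Fin 2 → EReal) × (Fin 2 → EReal)) : ℝ :=
  (∫ x, discriminator d x ∂(mixture μs)) + ∫ x, (1 - discriminator d x) ∂(mixture μ)

/-- `d` is an optimal discriminator for the generator `G_μ` against the truth `G_{μ*}`:
it belongs to `argmax_{ℓ, r} L(μ, ℓ, r)`. -/
def IsOptimalDiscriminator (μs μ : Param) (d : (Fin 2 → EReal) × (Fin 2 → EReal)) : Prop :=
  d ∈ Admissible ∧ ∀ d' ∈ Admissible, loss μs μ d' ≤ loss μs μ d

/-- `μ` is a run of the optimal discriminator dynamics for the truth `G_{μ*}` with step size `η`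
and additive perturbation `ξ`: at each step, for some optimal discriminator `d` at `μ⁽ᵗ⁾`,
`μ⁽ᵗ⁺¹⁾ = μ⁽ᵗ⁾ - η ∇_μ L(μ⁽ᵗ⁾, d) + ξ⁽ᵗ⁾`, the gradient being taken with `d` held fixed. -/
def IsOptDiscDynamics (μs : Param) (η : ℝ) (ξ : ℕ → Param) (μ : ℕ → Param) : Prop :=
  ∀ t, ∃ d, IsOptimalDiscriminator μs (μ t) d ∧
    μ (t + 1) = μ t - η • gradient (fun ν => loss μs ν d) (μ t) + ξ t

/-- Both means lie in `[-C, C]` and are at distance at least `δ` from one another. -/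
def BoundedSeparated (C δ : ℝ) (μ : Param) : Prop :=
  (∀ i, |μ i| ≤ C) ∧ δ ≤ |μ 0 - μ 1|

end GaussGAN

/-! The dynamics is gradient descent on the total variation distance. Write `gap` for the density of
the truth minus that of the generator. A discriminator supported on `A` has loss `1 + ∫_A gap`,
which among all measurable sets is largest on `posSet = {gap > 0}`. Since `gap` is `phi` times a sum
of four exponentials, it has at most three sign changes, so two intervals suffice
(`exists_admissible_ae_eq`). The maximizer is unique up to a null set unless `gap` vanishes
identically (`IsOptimalDiscriminator.ae_eq`). A step therefore adds `η / 2 * gder posSet m` to each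
mean `m`, where `gder A` is the derivative in the mean of the Gaussian mass of `A`.

Everything is measured in powers of one small number `E = exp (-r ^ 2) = δ * exp (-C ^ 2)`. Four
facts carry the argument. (i) If the distance is at least `E / 2` and the generator means are `E ^
8` apart, one gradient component is at least `E ^ 90` in size (`exists_le_abs_gder`). For a
generator shifted to one side of the truth, an outer mean feels a force of definite sign. In the
nested case `posSet` or its complement is an interval, and the force vanishes only at its midpoint,
which cannot be both means. (ii) Means beyond `r + 2` are not pushed further out (`abs_step_le`).
(iii) Nearly equal means are not drawn together (`gder_le_gder_of_close`), so the separation needed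
in (i) persists. (iv) Away from the optimum, `posSet` is stable under small moves: it changes only
where `gap` is tiny, and a Remez inequality for exponential sums makes that region small
(`abs_gder_posSet_sub_le`).

By (i) and (iv) each step with distance at least `E / 2` lowers it by `η * E ^ 181`; from below `E /
2` a step cannot climb above `E`. As the distance starts at most 1, about `1 / (η * E ^ 181)` steps
suffice. Every estimate tolerates a perturbation of size `τ`, and for small `σ` all `T` Gaussian
perturbations are below `τ` with probability at least `1 - p`. -/

namespace GaussGAN

/-! ### The normal density and its first derivatives -/

/-- The standard normal density. -/
noncomputable def phi (y : ℝ) : ℝ := (√(2 * Real.pi))⁻¹ * Real.exp (-y ^ 2 / 2)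

/-- Minus the derivative of the standard normal density. -/
noncomputable def psi (y : ℝ) : ℝ := y * phi y

lemma phi_pos (y : ℝ) : 0 < phi y := by unfold phi; positivity

lemma phi_neg (y : ℝ) : phi (-y) = phi y := by simp [phi]

lemma psi_neg (y : ℝ) : psi (-y) = -psi y := by simp [psi, phi_neg]

lemma one_le_sqrt_two_pi : 1 ≤ √(2 * Real.pi) := by
  rw [Real.one_le_sqrt]; linarith [Real.pi_gt_three]

lemma sqrt_two_pi_le : √(2 * Real.pi) ≤ 3 := by
  rw [Real.sqrt_le_left (by norm_num)]; linarith [Real.pi_lt_four]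

lemma phi_le_exp_half (y : ℝ) : phi y ≤ Real.exp (-y ^ 2 / 2) :=
  mul_le_of_le_one_left (Real.exp_pos _).le (inv_le_one_of_one_le₀ one_le_sqrt_two_pi)

lemma exp_half_le_phi (y : ℝ) : Real.exp (-y ^ 2 / 2) / 3 ≤ phi y := by
  unfold phi
  rw [div_eq_inv_mul]
  gcongr
  exact sqrt_two_pi_le

lemma phi_eq_exp_mul (a x : ℝ) :
    phi (x - a) = phi x * Real.exp (a * x - a ^ 2 / 2) := by
  unfold phi
  rw [mul_assoc, ← Real.exp_add]
  congr 2
  ring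

lemma phi_le_phi {x y : ℝ} (h : |x| ≤ |y|) : phi y ≤ phi x := by
  unfold phi
  have := sq_le_sq.mpr h
  gcongr

lemma hasDerivAt_phi (y : ℝ) : HasDerivAt phi (-psi y) y := by
  have h : HasDerivAt (fun y : ℝ => -y ^ 2 / 2) (-y) y :=
    (((hasDerivAt_pow 2 y).fun_neg).div_const 2).congr_deriv (by norm_num; ring)
  exact ((h.exp).const_mul (√(2 * Real.pi))⁻¹).congr_deriv (by unfold psi phi; ring)

lemma hasDerivAt_psi (y : ℝ) : HasDerivAt psi ((1 - y ^ 2) * phi y) y := by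
  exact ((hasDerivAt_id y).fun_mul (hasDerivAt_phi y)).congr_deriv (by simp [psi]; ring)

lemma continuous_phi : Continuous phi := by unfold phi; fun_prop

lemma continuous_psi : Continuous psi := continuous_id.mul continuous_phi

lemma phi_le_exp (y : ℝ) : phi y ≤ Real.exp (-y ^ 2 / 4) :=
  (phi_le_exp_half y).trans (Real.exp_le_exp.mpr (by nlinarith [sq_nonneg y]))

lemma abs_psi_le_exp (y : ℝ) : |psi y| ≤ Real.exp (-y ^ 2 / 4) := by
  have h1 : |y| ≤ Real.exp (y ^ 2 / 4) := by
    have := Real.add_one_le_exp (y ^ 2 / 4)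
    nlinarith [sq_nonneg (|y| - 2), sq_abs y]
  calc |psi y| = |y| * phi y := by rw [psi, abs_mul, abs_of_pos (phi_pos y)]
    _ ≤ Real.exp (y ^ 2 / 4) * Real.exp (-y ^ 2 / 2) := by
      gcongr
      · exact (phi_pos y).le
      · exact phi_le_exp_half y
    _ = _ := by rw [← Real.exp_add]; ring_nf

lemma abs_psi_le_one (y : ℝ) : |psi y| ≤ 1 :=
  (abs_psi_le_exp y).trans (Real.exp_le_one_iff.mpr (by nlinarith [sq_nonneg y]))

lemma abs_deriv_psi_le (y : ℝ) : |(1 - y ^ 2) * phi y| ≤ 4 * Real.exp (-y ^ 2 / 4) := by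
  have h1 : |1 - y ^ 2| ≤ 4 * Real.exp (y ^ 2 / 4) := by
    have := Real.add_one_le_exp (y ^ 2 / 4)
    rw [abs_le]; constructor <;> nlinarith [sq_nonneg y]
  calc |(1 - y ^ 2) * phi y| = |1 - y ^ 2| * phi y := by rw [abs_mul, abs_of_pos (phi_pos y)]
    _ ≤ 4 * Real.exp (y ^ 2 / 4) * Real.exp (-y ^ 2 / 2) := by
      gcongr
      · exact (phi_pos y).le
      · exact phi_le_exp_half y
    _ = _ := by rw [mul_assoc, ← Real.exp_add]; ring_nf

lemma abs_phi_sub_le (x y : ℝ) : |phi x - phi y| ≤ |x - y| := by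
  have := Convex.norm_image_sub_le_of_norm_hasDerivWithin_le (f := phi) (f' := fun y => -psi y)
    (s := Set.univ) (C := 1) (x := y) (y := x) (fun z _ => (hasDerivAt_phi z).hasDerivWithinAt)
    (fun z _ => by simpa using abs_psi_le_one z) convex_univ trivial trivial
  simpa using this

/-- A shift by at most one only weakens the Gaussian envelope, because `z ^ 2 + (z - y) ^ 2 ≥ y ^ 2
/ 2`. The decay must survive because the bound is later integrated over the line. -/
lemma abs_psi_sub_le {y h : ℝ} (hh : |h| ≤ 1) :
    |psi (y - h) - psi y| ≤ 8 * Real.exp (-y ^ 2 / 8) * |h| := by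
  have key : ∀ z ∈ Set.uIcc y (y - h), ‖(1 - z ^ 2) * phi z‖ ≤ 8 * Real.exp (-y ^ 2 / 8) := by
    intro z hz
    have hz' : |z - y| ≤ 1 := by
      have := Set.abs_sub_left_of_mem_uIcc hz
      simp only [sub_sub_cancel_left, abs_neg] at this
      exact this.trans hh
    have h2 := (abs_le.mp hz')
    have h3 : (z - y) ^ 2 ≤ 1 := by nlinarith
    have e1 : Real.exp (1 / 4) ≤ 2 := by
      have := Real.exp_bound_div_one_sub_of_interval (x := 1/4) (by norm_num) (by norm_num)
      linarith
    calc ‖(1 - z ^ 2) * phi z‖ ≤ 4 * Real.exp (-z ^ 2 / 4) := abs_deriv_psi_le z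
      _ ≤ 4 * (Real.exp (1 / 4) * Real.exp (-y ^ 2 / 8)) := by
        rw [← Real.exp_add]
        gcongr
        nlinarith [sq_nonneg (2 * z - y)]
      _ ≤ 4 * (2 * Real.exp (-y ^ 2 / 8)) := by gcongr
      _ = _ := by ring
  have := Convex.norm_image_sub_le_of_norm_hasDerivWithin_le (f := psi)
    (s := Set.uIcc y (y - h)) (x := y) (y := y - h)
    (fun z _ => (hasDerivAt_psi z).hasDerivWithinAt) key (convex_uIcc _ _)
    Set.left_mem_uIcc Set.right_mem_uIcc
  simpa using this

lemma abs_phi_taylor_le {y h : ℝ} (hh : |h| ≤ 1) :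
    |phi (y - h) - phi y - h * psi y| ≤ 8 * Real.exp (-y ^ 2 / 8) * h ^ 2 := by
  have hd : ∀ t : ℝ, HasDerivAt (fun t => phi (y - t) - phi y - t * psi y)
      (psi (y - t) - psi y) t := by
    intro t
    have h1 : HasDerivAt (fun t => phi (y - t)) (psi (y - t)) t :=
      ((hasDerivAt_phi (y - t)).comp_const_sub y t).congr_deriv (by simp)
    exact ((h1.sub_const (phi y)).fun_sub ((hasDerivAt_id t).mul_const (psi y))).congr_deriv
      (by simp)
  have key : ∀ t ∈ Set.uIcc 0 h, ‖psi (y - t) - psi y‖ ≤ 8 * Real.exp (-y ^ 2 / 8) * |h| := by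
    intro t ht
    have ht' : |t| ≤ |h| := by simpa using Set.abs_sub_left_of_mem_uIcc ht
    exact (abs_psi_sub_le (ht'.trans hh)).trans (by gcongr)
  have := Convex.norm_image_sub_le_of_norm_hasDerivWithin_le
    (f := fun t => phi (y - t) - phi y - t * psi y)
    (s := Set.uIcc 0 h) (x := 0) (y := h)
    (fun z _ => (hd z).hasDerivWithinAt) key (convex_uIcc _ _)
    Set.left_mem_uIcc Set.right_mem_uIcc
  simp only [sub_zero, sub_self, zero_mul, Real.norm_eq_abs] at this
  calc _ ≤ _ := this
    _ = _ := by rw [mul_assoc, ← sq, sq_abs]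

/-! ### Integrals -/

lemma integrable_exp_shift {b : ℝ} (hb : 0 < b) (m : ℝ) :
    Integrable (fun x : ℝ => Real.exp (-(x - m) ^ 2 / b)) := by
  have := (integrable_exp_neg_mul_sq (b := 1 / b) (by positivity)).comp_sub_right m
  refine this.congr (ae_of_all _ fun x => ?_)
  simp only
  congr 1; ring

lemma integral_exp_shift (b m : ℝ) :
    ∫ x : ℝ, Real.exp (-(x - m) ^ 2 / b) = √(Real.pi * b) := by
  rw [integral_sub_right_eq_self (fun x : ℝ => Real.exp (-x ^ 2 / b)) m]
  have := integral_gaussian (1 / b)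
  rw [div_div_eq_mul_div, div_one] at this
  rw [← this]
  congr 1; ext x; congr 1; ring

lemma integrable_phi (m : ℝ) : Integrable (fun x => phi (x - m)) :=
  (integrable_exp_shift (b := 4) (by norm_num) m).mono'
    (continuous_phi.comp (continuous_id.sub continuous_const)).aestronglyMeasurable
    (ae_of_all _ fun x => by
      simpa [abs_of_pos (phi_pos _)] using phi_le_exp (x - m))

lemma integrable_psi (m : ℝ) : Integrable (fun x => psi (x - m)) :=
  (integrable_exp_shift (b := 4) (by norm_num) m).mono'
    (continuous_psi.comp (continuous_id.sub continuous_const)).aestronglyMeasurable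
    (ae_of_all _ fun x => abs_psi_le_exp (x - m))

lemma gaussianPDFReal_eq_phi (m x : ℝ) : gaussianPDFReal m 1 x = phi (x - m) := by
  simp [gaussianPDFReal, phi]

lemma integral_phi (m : ℝ) : ∫ x, phi (x - m) = 1 := by
  simp_rw [← gaussianPDFReal_eq_phi]
  exact integral_gaussianPDFReal_eq_one m one_ne_zero

lemma tendsto_phi_atTop (m : ℝ) : Filter.Tendsto (fun x => phi (x - m)) Filter.atTop (nhds 0) := by
  have h : Filter.Tendsto (fun x : ℝ => (2 : ℝ) * Real.exp (-(x - m))) Filter.atTop (nhds (2 * 0)) := by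
    refine Filter.Tendsto.const_mul _ (Real.tendsto_exp_neg_atTop_nhds_zero.comp ?_)
    exact Filter.tendsto_atTop_add_const_right _ (-m) Filter.tendsto_id
  rw [mul_zero] at h
  refine squeeze_zero (fun x => (phi_pos _).le) (fun x => ?_) h
  calc phi (x - m) ≤ Real.exp (-(x - m) ^ 2 / 2) := phi_le_exp_half _
    _ ≤ Real.exp (1 / 2 + -(x - m)) := by
      gcongr; nlinarith [sq_nonneg (x - m - 1)]
    _ = Real.exp (1 / 2) * Real.exp (-(x - m)) := Real.exp_add _ _
    _ ≤ 2 * Real.exp (-(x - m)) := by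
      gcongr
      have := Real.exp_bound_div_one_sub_of_interval (x := 1/2) (by norm_num) (by norm_num)
      linarith

lemma tendsto_phi_atBot (m : ℝ) : Filter.Tendsto (fun x => phi (x - m)) Filter.atBot (nhds 0) := by
  have := (tendsto_phi_atTop (-m)).comp Filter.tendsto_neg_atBot_atTop
  refine this.congr fun x => ?_
  simp only [Function.comp]
  rw [← phi_neg]; congr 1; ring

/-! ### Gaussian mass of a set and its derivative in the mean -/

/-- Mass that `N(m, 1)` gives to `A`. -/
noncomputable def gmass (A : Set ℝ) (m : ℝ) : ℝ := ∫ x in A, phi (x - m)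

/-- Derivative of `gmass A` at `m`. -/
noncomputable def gder (A : Set ℝ) (m : ℝ) : ℝ := ∫ x in A, psi (x - m)

lemma hasDerivAt_neg_phi_shift (m x : ℝ) : HasDerivAt (fun x => -phi (x - m)) (psi (x - m)) x :=
  (((hasDerivAt_phi (x - m)).comp_sub_const x m).fun_neg).congr_deriv (by simp)

lemma gder_Iic (z m : ℝ) : gder (Set.Iic z) m = -phi (z - m) := by
  have := integral_Iic_of_hasDerivAt_of_tendsto' (a := z) (fun x _ => hasDerivAt_neg_phi_shift m x)
    (integrable_psi m).integrableOn (by simpa using (tendsto_phi_atBot m).neg)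
  simpa [gder] using this

lemma gder_Ioi (z m : ℝ) : gder (Set.Ioi z) m = phi (z - m) := by
  have := integral_Ioi_of_hasDerivAt_of_tendsto' (a := z) (fun x _ => hasDerivAt_neg_phi_shift m x)
    (integrable_psi m).integrableOn (by simpa using (tendsto_phi_atTop m).neg)
  simpa [gder] using this

lemma gder_univ (m : ℝ) : gder Set.univ m = 0 := by
  have h := integral_add_compl (μ := volume) (s := Set.Iic (0 : ℝ)) measurableSet_Iic (integrable_psi m)
  have h1 := gder_Iic 0 m
  have h2 := gder_Ioi 0 m
  unfold gder at *
  rw [Set.compl_Iic] at h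
  rw [setIntegral_univ, ← h, h1, h2]; ring

lemma gder_compl {A : Set ℝ} (hA : MeasurableSet A) (m : ℝ) : gder Aᶜ m = -gder A m := by
  have h := integral_add_compl hA (integrable_psi m)
  have h1 := gder_univ m
  rw [gder, setIntegral_univ] at h1
  rw [h1] at h
  unfold gder; linarith

lemma gder_congr {A B : Set ℝ} (h : A =ᵐ[volume] B) (m : ℝ) : gder A m = gder B m :=
  setIntegral_congr_set h

lemma gder_union {A B : Set ℝ} (h : Disjoint A B) (hB : MeasurableSet B) (m : ℝ) :
    gder (A ∪ B) m = gder A m + gder B m :=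
  setIntegral_union h hB (integrable_psi m).integrableOn (integrable_psi m).integrableOn

lemma gder_Icc {z w : ℝ} (h : z ≤ w) (m : ℝ) : gder (Set.Icc z w) m = phi (z - m) - phi (w - m) := by
  have h0 : (Set.Ioc z w : Set ℝ) =ᵐ[volume] Set.Icc z w := Ioc_ae_eq_Icc
  have h1 := gder_union (A := Set.Iic z) (B := Set.Ioc z w)
    (Set.disjoint_left.mpr fun x hx hx' => not_lt.mpr hx hx'.1) measurableSet_Ioc m
  rw [Set.Iic_union_Ioc_eq_Iic h, gder_Iic, gder_Iic, gder_congr h0] at h1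
  linarith

lemma gder_neg (A : Set ℝ) (m : ℝ) : gder (Neg.neg ⁻¹' A) (-m) = -gder A m := by
  have h := (Measure.measurePreserving_neg (volume : Measure ℝ)).setIntegral_preimage_emb
    (MeasurableEquiv.neg ℝ).measurableEmbedding (fun x => psi (x - m)) A
  unfold gder
  rw [← h, ← integral_neg]
  congr 1; ext x
  rw [← psi_neg]; congr 1; ring

lemma abs_gder_le (A : Set ℝ) (m : ℝ) : |gder A m| ≤ 4 := by
  calc |gder A m| ≤ ∫ x in A, |psi (x - m)| := abs_integral_le_integral_abs
    _ ≤ ∫ x, |psi (x - m)| :=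
      setIntegral_le_integral (integrable_psi m).abs (ae_of_all _ fun x => abs_nonneg _)
    _ ≤ ∫ x, Real.exp (-(x - m) ^ 2 / 4) :=
      integral_mono (integrable_psi m).abs (integrable_exp_shift (by norm_num) m)
        fun x => abs_psi_le_exp _
    _ = √(Real.pi * 4) := integral_exp_shift 4 m
    _ ≤ 4 := by
      rw [Real.sqrt_le_left (by norm_num)]; linarith [Real.pi_lt_four]

lemma sqrt_pi_mul_eight_le : √(Real.pi * 8) ≤ 6 := by
  rw [Real.sqrt_le_left (by norm_num)]; linarith [Real.pi_lt_four]

/-- The point is uniformity in `A`: in the descent estimate `A` itself depends on the increment `h`.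
-/
lemma abs_gmass_taylor_le (A : Set ℝ) (m : ℝ) {h : ℝ} (hh : |h| ≤ 1) :
    |gmass A (m + h) - gmass A m - h * gder A m| ≤ 48 * h ^ 2 := by
  have hi : Integrable fun x => phi (x - (m + h)) - phi (x - m) - h * psi (x - m) :=
    ((integrable_phi _).sub (integrable_phi _)).sub ((integrable_psi _).const_mul _)
  have hi2 : Integrable fun x => 8 * Real.exp (-(x - m) ^ 2 / 8) * h ^ 2 :=
    ((integrable_exp_shift (by norm_num) m).const_mul _).mul_const _
  have e : gmass A (m + h) - gmass A m - h * gder A m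
      = ∫ x in A, (phi (x - (m + h)) - phi (x - m) - h * psi (x - m)) := by
    unfold gmass gder
    have hs : Integrable fun x => phi (x - (m + h)) - phi (x - m) :=
      (integrable_phi _).sub (integrable_phi _)
    rw [← integral_const_mul, ← integral_sub (integrable_phi _).integrableOn
      (integrable_phi _).integrableOn, ← integral_sub hs.integrableOn
      ((integrable_psi _).const_mul _).integrableOn]
  rw [e]
  calc _ ≤ ∫ x in A, |phi (x - (m + h)) - phi (x - m) - h * psi (x - m)| :=
        abs_integral_le_integral_abs
    _ ≤ ∫ x, |phi (x - (m + h)) - phi (x - m) - h * psi (x - m)| :=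
      setIntegral_le_integral hi.abs (ae_of_all _ fun x => abs_nonneg _)
    _ ≤ ∫ x, 8 * Real.exp (-(x - m) ^ 2 / 8) * h ^ 2 :=
      integral_mono hi.abs hi2 fun x => by
        have := abs_phi_taylor_le (y := x - m) hh
        rwa [show x - m - h = x - (m + h) by ring] at this
    _ = 8 * √(Real.pi * 8) * h ^ 2 := by
      rw [integral_mul_const, integral_const_mul, integral_exp_shift]
    _ ≤ 8 * 6 * h ^ 2 := by gcongr; exact sqrt_pi_mul_eight_le
    _ = 48 * h ^ 2 := by ring

lemma hasDerivAt_gmass (A : Set ℝ) (m : ℝ) : HasDerivAt (gmass A) (gder A m) m := by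
  rw [hasDerivAt_iff_isLittleO_nhds_zero]
  have h1 : (fun h => gmass A (m + h) - gmass A m - h • gder A m) =O[nhds 0] fun h : ℝ => h ^ 2 := by
    refine Asymptotics.IsBigO.of_bound 48 ?_
    filter_upwards [Metric.closedBall_mem_nhds (0 : ℝ) one_pos] with h hh
    have hh' : |h| ≤ 1 := by simpa using hh
    have := abs_gmass_taylor_le A m hh'
    simpa using this
  refine h1.trans_isLittleO ?_
  simpa using Asymptotics.isLittleO_pow_id (𝕜 := ℝ) (n := 2) (by norm_num)

/-- Gaussian tails outside `[-R, R]`. -/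
lemma abs_setIntegral_le_tail {u : ℝ → ℝ} {m M R : ℝ} (hm : |m| ≤ M) (hMR : M ≤ R)
    (hu : ∀ x, |u x| ≤ Real.exp (-(x - m) ^ 2 / 4)) {A : Set ℝ} (hA : MeasurableSet A)
    (hAR : ∀ x ∈ A, R ≤ |x|) :
    |∫ x in A, u x| ≤ 6 * Real.exp (-(R - M) ^ 2 / 8) := by
  have hi : Integrable fun x => Real.exp (-(R - M) ^ 2 / 8) * Real.exp (-(x - m) ^ 2 / 8) :=
    (integrable_exp_shift (by norm_num) m).const_mul _
  have h1 : ∀ x ∈ A, |u x| ≤ Real.exp (-(R - M) ^ 2 / 8) * Real.exp (-(x - m) ^ 2 / 8) := by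
    intro x hx
    refine (hu x).trans ?_
    rw [← Real.exp_add]
    gcongr
    have h2 : R - M ≤ |x - m| := by
      have := abs_sub_abs_le_abs_sub x m
      linarith [hAR x hx]
    have h3 : (R - M) ^ 2 ≤ (x - m) ^ 2 := by
      rw [← sq_abs (x - m)]; exact pow_le_pow_left₀ (by linarith) h2 2
    linarith
  calc |∫ x in A, u x| ≤ ∫ x in A, Real.exp (-(R - M) ^ 2 / 8) * Real.exp (-(x - m) ^ 2 / 8) := by
        rw [← Real.norm_eq_abs]
        refine norm_integral_le_of_norm_le hi.integrableOn ?_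
        exact (ae_restrict_iff' hA).mpr (ae_of_all _ h1)
    _ ≤ ∫ x, Real.exp (-(R - M) ^ 2 / 8) * Real.exp (-(x - m) ^ 2 / 8) :=
      setIntegral_le_integral hi (ae_of_all _ fun x => by positivity)
    _ = Real.exp (-(R - M) ^ 2 / 8) * √(Real.pi * 8) := by
      rw [integral_const_mul, integral_exp_shift]
    _ ≤ _ := by
      rw [mul_comm]; gcongr; exact sqrt_pi_mul_eight_le

/-! ### Exponential sums: a Remez inequality and sign changes -/

/-- The exponential sum `∑ c * exp (a * x)` over the pairs `(c, a)` of a list. -/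
noncomputable def expSum (l : List (ℝ × ℝ)) (x : ℝ) : ℝ :=
  (l.map fun q => q.1 * Real.exp (q.2 * x)).sum

/-- The list of the derivative of `exp (-a * x) * expSum l x`. -/
def deflate (a : ℝ) (l : List (ℝ × ℝ)) : List (ℝ × ℝ) :=
  l.map fun q => (q.1 * (q.2 - a), q.2 - a)

lemma length_deflate (a : ℝ) (l : List (ℝ × ℝ)) : (deflate a l).length = l.length := by
  simp [deflate]

lemma hasDerivAt_exp_mul_expSum (a : ℝ) (l : List (ℝ × ℝ)) (x : ℝ) :
    HasDerivAt (fun x => Real.exp (-(a * x)) * expSum l x) (expSum (deflate a l) x) x := by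
  induction l with
  | nil => simpa [expSum, deflate] using hasDerivAt_const x (0 : ℝ)
  | cons q l ih =>
    have h1 : HasDerivAt (fun x => q.1 * Real.exp ((q.2 - a) * x))
        (q.1 * (q.2 - a) * Real.exp ((q.2 - a) * x)) x :=
      ((((hasDerivAt_id x).const_mul (q.2 - a)).exp).const_mul q.1).congr_deriv (by simp; ring)
    have h2 := h1.fun_add ih
    have e : (fun x => Real.exp (-(a * x)) * expSum (q :: l) x)
        = fun x => q.1 * Real.exp ((q.2 - a) * x) + Real.exp (-(a * x)) * expSum l x := by
      ext x
      have : Real.exp ((q.2 - a) * x) = Real.exp (-(a * x)) * Real.exp (q.2 * x) := by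
        rw [← Real.exp_add]; ring_nf
      simp only [expSum, List.map_cons, List.sum_cons]
      rw [this]; ring
    rw [e]
    exact h2.congr_deriv (by simp [expSum, deflate])

/-- Multiplying by `exp (-a * x)` makes the term of frequency `a` constant, and differentiation
kills it. Both inductions below shorten the sum this way. -/
lemma expSum_deflate_cons (c a : ℝ) (l : List (ℝ × ℝ)) (x : ℝ) :
    expSum (deflate a ((c, a) :: l)) x = expSum (deflate a l) x := by
  simp [expSum, deflate]

lemma hasDerivAt_exp_mul_expSum_cons (c a : ℝ) (l : List (ℝ × ℝ)) (x : ℝ) :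
    HasDerivAt (fun x => Real.exp (-(a * x)) * expSum ((c, a) :: l) x)
      (expSum (deflate a l) x) x := by
  have := hasDerivAt_exp_mul_expSum a ((c, a) :: l) x
  rwa [expSum_deflate_cons] at this

/-- A Remez-type inequality for exponential sums. -/
theorem abs_expSum_le_of_separated (n : ℕ) : ∀ (l : List (ℝ × ℝ)), l.length = n + 1 →
    ∀ {M R s ε : ℝ}, 0 ≤ M → 1 ≤ R → 0 < s → s ≤ 1 → 0 ≤ ε → (∀ q ∈ l, |q.2| ≤ M) →
    ∀ x : ℕ → ℝ, (∀ i < 2 ^ n, |x i| ≤ R) → (∀ i, i + 1 < 2 ^ n → x i + s ≤ x (i + 1)) →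
    (∀ i < 2 ^ n, |expSum l (x i)| ≤ ε) → ∀ y, |y| ≤ R →
    |expSum l y| ≤ Real.exp ((2 ^ (n + 2) - 2) * (M * R)) * (5 * R / s) ^ n * ε := by
  induction n with
  | zero =>
    intro l hl M R s ε hM hR hs hs1 hε hlM x hxR _ hxε y hy
    obtain ⟨⟨c, a⟩, rfl⟩ := List.length_eq_one_iff.mp hl
    have ha : |a| ≤ M := hlM (c, a) (by simp)
    have h0 := hxε 0 (by norm_num)
    have hx0 := hxR 0 (by norm_num)
    simp only [expSum, List.map_cons, List.map_nil, List.sum_cons, List.sum_nil, add_zero,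
      abs_mul, Real.abs_exp] at h0 ⊢
    have e : Real.exp (a * y) = Real.exp (a * x 0) * Real.exp (a * (y - x 0)) := by
      rw [← Real.exp_add]; ring_nf
    have h1 : a * (y - x 0) ≤ 2 * (M * R) := by
      calc a * (y - x 0) ≤ |a * (y - x 0)| := le_abs_self _
        _ = |a| * |y - x 0| := abs_mul _ _
        _ ≤ M * (2 * R) := by
          gcongr
          exact (abs_sub _ _).trans (by linarith)
        _ = _ := by ring
    calc |c| * Real.exp (a * y) = Real.exp (a * (y - x 0)) * (|c| * Real.exp (a * x 0)) := by
          rw [e]; ring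
      _ ≤ Real.exp (2 * (M * R)) * ε := by gcongr
      _ = _ := by norm_num
  | succ n ih =>
    intro l hl M R s ε hM hR hs hs1 hε hlM x hxR hxs hxε y hy
    obtain ⟨⟨c, a⟩, l, rfl⟩ := List.exists_cons_of_length_eq_add_one hl
    have ha : |a| ≤ M := hlM (c, a) (by simp)
    have hexp : ∀ z, |z| ≤ R → ∀ b, |b| ≤ M → Real.exp (b * z) ≤ Real.exp (M * R) := by
      intro z hz b hb
      apply Real.exp_le_exp.mpr
      calc b * z ≤ |b * z| := le_abs_self _
        _ = |b| * |z| := abs_mul _ _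
        _ ≤ M * R := by gcongr
    set H : ℝ → ℝ := fun x => Real.exp (-(a * x)) * expSum ((c, a) :: l) x with hH
    have hd : ∀ z, HasDerivAt H (expSum (deflate a l) z) z := hasDerivAt_exp_mul_expSum_cons c a l
    have hHx : ∀ i < 2 ^ (n + 1), |H (x i)| ≤ Real.exp (M * R) * ε := by
      intro i hi
      rw [hH]
      simp only [abs_mul, Real.abs_exp]
      have h1 := hexp _ (hxR i hi) (-a) (by rwa [abs_neg])
      rw [neg_mul] at h1
      exact mul_le_mul h1 (hxε i hi) (abs_nonneg _) (Real.exp_pos _).le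
    -- The mean value theorem is applied on disjoint pairs of points. This halves their number but
    -- keeps the gap `s`, since the whole interval from `x (2 * i + 1)` to `x (2 * i + 2)` separates
    -- consecutive `ξ`.
    have hmv : ∀ i : ℕ, ∃ ξ : ℝ, i < 2 ^ n → ξ ∈ Set.Ioo (x (2 * i)) (x (2 * i + 1)) ∧
        |expSum (deflate a l) ξ| ≤ 2 * Real.exp (M * R) * ε / s := by
      intro i
      by_cases hi : i < 2 ^ n
      · have hi1 : 2 * i + 1 < 2 ^ (n + 1) := by rw [pow_succ]; omega
        have hlt := hxs (2 * i) hi1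
        obtain ⟨ξ, hξ, e⟩ := exists_hasDerivAt_eq_slope H (expSum (deflate a l))
          (show x (2 * i) < x (2 * i + 1) by linarith)
          (fun z _ => (hd z).continuousAt.continuousWithinAt) (fun z _ => hd z)
        refine ⟨ξ, fun _ => ⟨hξ, ?_⟩⟩
        rw [e, abs_div]
        have h1 := hHx (2 * i + 1) hi1
        have h2 := hHx (2 * i) (by omega)
        have h3 := abs_sub (H (x (2 * i + 1))) (H (x (2 * i)))
        have h4 : s ≤ |x (2 * i + 1) - x (2 * i)| := (by linarith : s ≤ _).trans (le_abs_self _)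
        gcongr
        linarith
      · exact ⟨0, fun h => absurd h hi⟩
    choose ξ hξ using hmv
    have hξR : ∀ i < 2 ^ n, |ξ i| ≤ R := by
      intro i hi
      have h1 := abs_le.mp (hxR (2 * i) (by rw [pow_succ]; omega))
      have h2 := abs_le.mp (hxR (2 * i + 1) (by rw [pow_succ]; omega))
      have h3 := (hξ i hi).1
      rw [abs_le]; constructor <;> linarith [h3.1, h3.2]
    have hIH := ih (deflate a l) (by rw [length_deflate]; simpa using hl) (M := 2 * M) (R := R)
      (s := s) (ε := 2 * Real.exp (M * R) * ε / s) (by linarith) hR hs hs1 (by positivity)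
      (by
        intro q hq
        obtain ⟨p, hp, rfl⟩ := List.mem_map.mp hq
        have := hlM p (List.mem_cons_of_mem _ hp)
        exact (abs_sub _ _).trans (by linarith))
      ξ hξR
      (by
        intro i hi
        have h1 := (hξ i (by omega)).1.2
        have h2 := (hξ (i + 1) hi).1.1
        have h3 := hxs (2 * i + 1) (by rw [pow_succ]; omega)
        rw [show 2 * (i + 1) = 2 * i + 1 + 1 by ring] at h2
        linarith)
      (fun i hi => (hξ i hi).2)
    set B := Real.exp ((2 ^ (n + 2) - 2) * (2 * M * R)) * (5 * R / s) ^ n *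
      (2 * Real.exp (M * R) * ε / s) with hB
    -- The bound on the derivative is integrated back from the point `x 0`, where `H` is known to be
    -- small.
    have hlip : |H y - H (x 0)| ≤ B * |y - x 0| := by
      have := Convex.norm_image_sub_le_of_norm_hasDerivWithin_le (f := H)
        (s := Set.Icc (-R) R) (C := B) (x := x 0) (y := y)
        (fun z _ => (hd z).hasDerivWithinAt)
        (fun z hz => hIH z (abs_le.mpr hz)) (convex_Icc _ _)
        (abs_le.mp (hxR 0 (by positivity))) (abs_le.mp hy)
      simpa using this
    have hx0 := hxR 0 (by positivity)
    have hB0 : 0 ≤ B := by positivity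
    have hHy : |H y| ≤ Real.exp (M * R) * ε + 2 * R * B := by
      have h1 : |y - x 0| ≤ 2 * R := (abs_sub _ _).trans (by linarith)
      have h2 := hHx 0 (by positivity)
      have h3 : |H y| ≤ |H y - H (x 0)| + |H (x 0)| := by
        have := abs_add_le (H y - H (x 0)) (H (x 0)); simpa using this
      have h4 : B * |y - x 0| ≤ B * (2 * R) := by gcongr
      linarith
    have e1 : expSum ((c, a) :: l) y = Real.exp (a * y) * H y := by
      rw [hH]; simp only
      rw [← mul_assoc, ← Real.exp_add]; simp
    have h5 : |expSum ((c, a) :: l) y| ≤ Real.exp (M * R) * (Real.exp (M * R) * ε + 2 * R * B) := by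
      rw [e1, abs_mul, Real.abs_exp]
      exact mul_le_mul (hexp y hy a ha) hHy (abs_nonneg _) (Real.exp_pos _).le
    refine h5.trans ?_
    set X := Real.exp (M * R)
    set Y := Real.exp ((2 ^ (n + 2) - 2) * (2 * M * R))
    have hY : 1 ≤ Y := by
      apply Real.one_le_exp
      have : (2 : ℝ) ≤ 2 ^ (n + 2) := by
        calc (2 : ℝ) = 2 ^ 1 := by norm_num
          _ ≤ _ := pow_le_pow_right₀ (by norm_num) (by omega)
      have h6 : 0 ≤ 2 ^ (n + 2) - (2 : ℝ) := by linarith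
      positivity
    have hq : 1 ≤ R / s := by rw [le_div_iff₀ hs]; linarith
    have hqn : 1 ≤ (5 * R / s) ^ n := one_le_pow₀ (by rw [mul_div_assoc]; linarith)
    have e2 : Real.exp ((2 ^ (n + 1 + 2) - 2) * (M * R)) = X ^ 2 * Y := by
      rw [← Real.exp_nat_mul, ← Real.exp_add]; push_cast; ring_nf
    rw [e2, hB]
    have h7 : X * (X * ε + 2 * R * (Y * (5 * R / s) ^ n * (2 * X * ε / s)))
        = X ^ 2 * ε * (1 + 4 * (R / s) * (Y * (5 * R / s) ^ n)) := by field_simp; ring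
    have h8 : X ^ 2 * Y * (5 * R / s) ^ (n + 1) * ε
        = X ^ 2 * ε * (5 * (R / s) * (Y * (5 * R / s) ^ n)) := by
      rw [pow_succ]; ring
    rw [h7, h8]
    gcongr
    have : 1 * 1 ≤ (R / s) * (Y * (5 * R / s) ^ n) := by
      gcongr
      nlinarith
    linarith

/-- A sum of `n` exponentials does not alternate in sign along `n + 1` points. -/
theorem expSum_not_alternating (n : ℕ) : ∀ (l : List (ℝ × ℝ)), l.length = n →
    ∀ (σ : ℝ) (x : ℕ → ℝ), (∀ i < n, x i < x (i + 1)) →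
    (∀ i ≤ n, 0 ≤ σ * (-1) ^ i * expSum l (x i)) →
    (∀ i < n, σ * expSum l (x i) ≠ 0 ∨ σ * expSum l (x (i + 1)) ≠ 0) →
    (n = 0 → σ * expSum l (x 0) ≠ 0) → False := by
  induction n with
  | zero =>
    intro l hl σ x _ _ _ h
    rw [List.length_eq_zero_iff.mp hl] at h
    simp [expSum] at h
  | succ n ih =>
    intro l hl σ x hx h0 hne _
    obtain ⟨⟨c, a⟩, l, rfl⟩ := List.exists_cons_of_length_eq_add_one hl
    have hd := hasDerivAt_exp_mul_expSum_cons c a l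
    -- As in Rolle's theorem, slopes between alternating values alternate too, with one point and
    -- one exponential fewer. They alternate strictly because two neighbouring values never both
    -- vanish.
    have hmv : ∀ i : ℕ, ∃ ξ : ℝ, i < n + 1 → ξ ∈ Set.Ioo (x i) (x (i + 1)) ∧
        0 < (-σ) * (-1) ^ i * expSum (deflate a l) ξ := by
      intro i
      by_cases hi : i < n + 1
      · obtain ⟨ξ, hξ, e⟩ := exists_hasDerivAt_eq_slope _ _ (hx i hi)
          (fun z _ => (hd z).continuousAt.continuousWithinAt) (fun z _ => hd z)
        refine ⟨ξ, fun _ => ⟨hξ, ?_⟩⟩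
        have h1 := h0 i hi.le
        have h2 := h0 (i + 1) hi
        have h3 := hne i hi
        have h4 := sub_pos.mpr (hx i hi)
        rw [e, ← mul_div_assoc]
        refine div_pos ?_ h4
        set u := expSum ((c, a) :: l) (x i)
        set v := expSum ((c, a) :: l) (x (i + 1))
        have p1 := Real.exp_pos (-(a * x i))
        have p2 := Real.exp_pos (-(a * x (i + 1)))
        rw [pow_succ] at h2
        have e3 : -σ * (-1) ^ i * (Real.exp (-(a * x (i + 1))) * v - Real.exp (-(a * x i)) * u)
          = Real.exp (-(a * x (i + 1))) * (σ * ((-1) ^ i * -1) * v)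
            + Real.exp (-(a * x i)) * (σ * (-1) ^ i * u) := by ring
        rw [e3]
        rcases h3 with h3 | h3
        · have : 0 < σ * (-1) ^ i * u := lt_of_le_of_ne h1 (by
            intro h; apply h3
            rcases neg_one_pow_eq_or ℝ i with hh | hh <;> rw [hh] at h <;> linarith)
          positivity
        · have : 0 < σ * ((-1) ^ i * -1) * v := lt_of_le_of_ne h2 (by
            intro h; apply h3
            rcases neg_one_pow_eq_or ℝ i with hh | hh <;> rw [hh] at h <;> linarith)
          positivity
      · exact ⟨0, fun h => absurd h hi⟩
    choose ξ hξ using hmv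
    have hnz : ∀ i < n + 1, -σ * expSum (deflate a l) (ξ i) ≠ 0 := by
      intro i hi h
      have := (hξ i hi).2
      rw [mul_right_comm, h, zero_mul] at this
      exact lt_irrefl _ this
    refine ih (deflate a l) (by rw [length_deflate]; simpa using hl) (-σ) ξ ?_ ?_ ?_ ?_
    · intro i hi
      exact (hξ i (by omega)).1.2.trans (hξ (i + 1) (by omega)).1.1
    · intro i hi
      exact (hξ i (by omega)).2.le
    · intro i hi
      exact Or.inl (hnz i (by omega))
    · intro _
      exact hnz 0 (by omega)

/-- Either `E` has `n` points with gaps at least `s`, or its measure is at most `2 n s`. -/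
lemma exists_separated_or_volume_le (n : ℕ) {s : ℝ} (hs : 0 < s) : ∀ E : Set ℝ, BddBelow E →
    (∃ x : ℕ → ℝ, (∀ i < n, x i ∈ E) ∧ ∀ i, i + 1 < n → x i + s ≤ x (i + 1)) ∨
      volume E ≤ ENNReal.ofReal (2 * n * s) := by
  induction n with
  | zero => exact fun E _ => Or.inl ⟨0, by simp, by simp⟩
  | succ n ih =>
    intro E hE
    rcases E.eq_empty_or_nonempty with rfl | hne
    · right; simp
    -- Greedy choice: with `x0` within `s` of the infimum, the part of `E` to the left of `x0 + s`
    -- fits into an interval of length `2 * s`.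
    obtain ⟨x0, hx0, hlt⟩ := exists_lt_of_csInf_lt hne (show sInf E < sInf E + s by linarith)
    rcases ih (E ∩ Set.Ici (x0 + s)) (hE.mono Set.inter_subset_left) with ⟨x, hx, hxs⟩ | hv
    · left
      refine ⟨fun i => if i = 0 then x0 else x (i - 1), ?_, ?_⟩
      · intro i hi
        rcases i with _ | i
        · simpa using hx0
        · simpa using (hx i (by omega)).1
      · intro i hi
        rcases i with _ | i
        · simpa using (hx 0 (by omega)).2
        · simpa using hxs i (by omega)
    · right
      have hsub : E ⊆ Set.Icc (sInf E) (sInf E + 2 * s) ∪ E ∩ Set.Ici (x0 + s) := by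
        intro y hy
        by_cases h : x0 + s ≤ y
        · exact Or.inr ⟨hy, h⟩
        · exact Or.inl ⟨csInf_le hE hy, by linarith⟩
      calc volume E ≤ _ := measure_mono hsub
        _ ≤ volume (Set.Icc (sInf E) (sInf E + 2 * s)) + volume (E ∩ Set.Ici (x0 + s)) :=
          measure_union_le _ _
        _ ≤ ENNReal.ofReal (2 * s) + ENNReal.ofReal (2 * n * s) := by
          gcongr
          rw [Real.volume_Icc]; simp
        _ = ENNReal.ofReal (2 * (n + 1 : ℕ) * s) := by
          rw [← ENNReal.ofReal_add (by positivity) (by positivity)]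
          congr 1; push_cast; ring

/-! ### Differences of mixture densities -/

/-- Density of the mixture of `N(a, 1)` and `N(b, 1)`. -/
noncomputable def den (a b x : ℝ) : ℝ := (phi (x - a) + phi (x - b)) / 2

/-- Difference of the densities of two mixtures. -/
noncomputable def gap (a b c d x : ℝ) : ℝ := den a b x - den c d x

lemma gap_eq_expSum (a b c d x : ℝ) : gap a b c d x = phi x *
    expSum [(Real.exp (-a ^ 2 / 2) / 2, a), (Real.exp (-b ^ 2 / 2) / 2, b),
      (-Real.exp (-c ^ 2 / 2) / 2, c), (-Real.exp (-d ^ 2 / 2) / 2, d)] x := by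
  have h : ∀ m : ℝ, phi (x - m) = phi x * (Real.exp (-m ^ 2 / 2) * Real.exp (m * x)) := by
    intro m
    rw [phi_eq_exp_mul, ← Real.exp_add]; congr 2; ring
  simp only [gap, den, expSum, List.map_cons, List.map_nil, List.sum_cons, List.sum_nil, h]
  ring

lemma gap_swap (a b c d x : ℝ) : gap c d a b x = -gap a b c d x := by unfold gap; ring

lemma gap_comm_left (a b c d : ℝ) : gap b a c d = gap a b c d := by
  ext x; unfold gap den; ring

lemma gap_comm_right (a b c d : ℝ) : gap a b d c = gap a b c d := by
  ext x; unfold gap den; ring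

lemma gap_neg (a b c d x : ℝ) : gap (-a) (-b) (-c) (-d) (-x) = gap a b c d x := by
  have h : ∀ m : ℝ, phi (-x - -m) = phi (x - m) := fun m => by rw [← phi_neg]; congr 1; ring
  simp only [gap, den, h]

lemma continuous_den (a b : ℝ) : Continuous (den a b) := by
  have := continuous_phi
  unfold den; fun_prop

lemma continuous_gap (a b c d : ℝ) : Continuous (gap a b c d) :=
  (continuous_den a b).sub (continuous_den c d)

/-- The positive set of a difference of mixtures consists of at most two intervals. -/
lemma gap_not_alternating (a b c d : ℝ) {x₀ x₁ x₂ x₃ x₄ : ℝ} (h01 : x₀ < x₁) (h12 : x₁ < x₂)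
    (h23 : x₂ < x₃) (h34 : x₃ < x₄) (h0 : 0 < gap a b c d x₀) (h1 : gap a b c d x₁ ≤ 0)
    (h2 : 0 < gap a b c d x₂) (h3 : gap a b c d x₃ ≤ 0) (h4 : 0 < gap a b c d x₄) : False := by
  set l := [(Real.exp (-a ^ 2 / 2) / 2, a), (Real.exp (-b ^ 2 / 2) / 2, b),
    (-Real.exp (-c ^ 2 / 2) / 2, c), (-Real.exp (-d ^ 2 / 2) / 2, d)] with hl
  have hpos : ∀ x, 0 < gap a b c d x → 0 < expSum l x := fun x h => by
    rw [gap_eq_expSum] at h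
    exact (mul_pos_iff_of_pos_left (phi_pos x)).mp h
  have hnp : ∀ x, gap a b c d x ≤ 0 → expSum l x ≤ 0 := fun x h => by
    rw [gap_eq_expSum] at h
    exact le_of_not_gt fun h' => h.not_gt (mul_pos (phi_pos x) h')
  have e0 := hpos _ h0
  have e1 := hnp _ h1
  have e2 := hpos _ h2
  have e3 := hnp _ h3
  have e4 := hpos _ h4
  refine expSum_not_alternating 4 l rfl 1
    (fun i => if i = 0 then x₀ else if i = 1 then x₁ else if i = 2 then x₂ else if i = 3 then x₃
      else x₄) ?_ ?_ ?_ (by norm_num)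
  · intro i hi
    interval_cases i <;> simpa
  · intro i hi
    interval_cases i <;> simp <;> linarith
  · intro i hi
    interval_cases i <;> simp
    exacts [Or.inl e0.ne', Or.inr e2.ne', Or.inl e2.ne', Or.inr e4.ne']

/-- Alternative for the sublevel sets of a difference of mixtures. -/
lemma volume_sublevel_gap_le_or {a b c d M R s ε : ℝ} (hR : 1 ≤ R) (hs : 0 < s)
    (hs1 : s ≤ 1) (hε : 0 ≤ ε) (ha : |a| ≤ M) (hb : |b| ≤ M) (hc : |c| ≤ M) (hd : |d| ≤ M) :
    volume ({x | |gap a b c d x| ≤ ε} ∩ Set.Icc (-R) R) ≤ ENNReal.ofReal (16 * s) ∨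
    ∀ y, |y| ≤ R → |gap a b c d y| ≤
      Real.exp (30 * (M * R)) * (5 * R / s) ^ 3 * (3 * Real.exp (R ^ 2 / 2) * ε) := by
  -- Eight points, because the Remez inequality for four exponentials needs `2 ^ 3` of them.
  rcases exists_separated_or_volume_le 8 hs ({x | |gap a b c d x| ≤ ε} ∩ Set.Icc (-R) R)
    (bddBelow_Icc.mono Set.inter_subset_right) with ⟨x, hx, hxs⟩ | h
  · right
    intro y hy
    have key := abs_expSum_le_of_separated 3
      [(Real.exp (-a ^ 2 / 2) / 2, a), (Real.exp (-b ^ 2 / 2) / 2, b),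
      (-Real.exp (-c ^ 2 / 2) / 2, c), (-Real.exp (-d ^ 2 / 2) / 2, d)] rfl
      (M := M) (R := R) (s := s) (ε := 3 * Real.exp (R ^ 2 / 2) * ε)
      ((abs_nonneg a).trans ha) hR hs hs1 (by positivity) (by simp [ha, hb, hc, hd])
      x (fun i hi => abs_le.mpr (hx i hi).2) hxs
      (by
        intro i hi
        have h1 := (hx i hi).1
        have h2 := (hx i hi).2
        change |gap a b c d (x i)| ≤ ε at h1
        rw [gap_eq_expSum] at h1
        rw [abs_mul, abs_of_pos (phi_pos _)] at h1
        set S := |expSum _ (x i)|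
        have h3 : Real.exp (-R ^ 2 / 2) / 3 ≤ phi (x i) := by
          refine le_trans ?_ (exp_half_le_phi (x i))
          have : x i ^ 2 ≤ R ^ 2 := sq_le_sq' h2.1 h2.2
          gcongr
        have h4 := (mul_le_mul_of_nonneg_right h3 (abs_nonneg _)).trans h1
        have e : Real.exp (R ^ 2 / 2) * Real.exp (-R ^ 2 / 2) = 1 := by
          rw [← Real.exp_add]; ring_nf; simp
        calc S = 3 * (Real.exp (R ^ 2 / 2) * (Real.exp (-R ^ 2 / 2) / 3 * S)) := by
              rw [← mul_assoc (Real.exp _), ← mul_div_assoc, e]; ring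
          _ ≤ 3 * (Real.exp (R ^ 2 / 2) * ε) := by gcongr
          _ = _ := by ring)
      y hy
    rw [gap_eq_expSum, abs_mul, abs_of_pos (phi_pos _)]
    have hp : phi y ≤ 1 := (phi_le_exp y).trans (Real.exp_le_one_iff.mpr (by nlinarith [sq_nonneg y]))
    refine (mul_le_of_le_one_left (abs_nonneg _) hp).trans ?_
    norm_num at key ⊢
    exact key
  · left
    rwa [show (2 * (8 : ℕ) * s : ℝ) = 16 * s by norm_num] at h

/-- Take `ε = 0` in `volume_sublevel_gap_le_or` and let `s` tend to 0: the second alternative would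
make `gap` vanish at the given point. -/
lemma volume_gap_eq_zero {a b c d : ℝ} (h : ∃ x, gap a b c d x ≠ 0) :
    volume {x | gap a b c d x = 0} = 0 := by
  obtain ⟨x₀, hx₀⟩ := h
  set M := max (max |a| |b|) (max |c| |d|)
  have hcov : {x | gap a b c d x = 0} ⊆
      ⋃ n : ℕ, {x | |gap a b c d x| ≤ 0} ∩ Set.Icc (-(n + (1 + |x₀|))) (n + (1 + |x₀|)) := by
    intro x hx
    obtain ⟨n, hn⟩ := exists_nat_ge |x|
    refine Set.mem_iUnion.mpr ⟨n, by simpa using hx, ?_⟩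
    refine abs_le.mp ?_
    linarith [abs_nonneg x₀]
  refine measure_mono_null hcov (measure_iUnion_null fun n => ?_)
  set R : ℝ := n + (1 + |x₀|)
  have hR : 1 ≤ R := by have := abs_nonneg x₀; have : (0 : ℝ) ≤ n := n.cast_nonneg; grind
  have hx₀R : |x₀| ≤ R := by have : (0 : ℝ) ≤ n := n.cast_nonneg; grind
  have key : ∀ k : ℕ, volume ({x | |gap a b c d x| ≤ 0} ∩ Set.Icc (-R) R)
      ≤ ENNReal.ofReal (16 * (1 / ((k : ℝ) + 1))) := by
    intro k
    rcases volume_sublevel_gap_le_or (a := a) (b := b) (c := c) (d := d) (M := M) (R := R)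
      (s := 1 / ((k : ℝ) + 1)) (ε := 0) hR (by positivity)
      (by rw [div_le_one (by positivity)]; linarith [(Nat.cast_nonneg k : (0:ℝ) ≤ k)]) le_rfl
      (by grind) (by grind) (by grind) (by grind) with h | h
    · exact h
    · exfalso
      have := h x₀ hx₀R
      simp only [mul_zero, abs_nonpos_iff] at this
      exact hx₀ this
  have hlim : Filter.Tendsto (fun k : ℕ => ENNReal.ofReal (16 * (1 / ((k : ℝ) + 1))))
      Filter.atTop (nhds 0) := by
    have := (tendsto_one_div_add_atTop_nhds_zero_nat (𝕜 := ℝ)).const_mul 16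
    simpa using ENNReal.tendsto_ofReal this
  exact le_antisymm (ge_of_tendsto' hlim key) zero_le

lemma integrable_den (a b : ℝ) : Integrable (den a b) :=
  ((integrable_phi a).add (integrable_phi b)).div_const 2

lemma integrable_gap (a b c d : ℝ) : Integrable (gap a b c d) :=
  (integrable_den a b).sub (integrable_den c d)

lemma den_pos (a b x : ℝ) : 0 < den a b x := by
  have := phi_pos (x - a); have := phi_pos (x - b); unfold den; positivity

lemma setIntegral_den (A : Set ℝ) (a b : ℝ) : ∫ x in A, den a b x = (gmass A a + gmass A b) / 2 := by
  unfold den gmass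
  rw [integral_div, integral_add (integrable_phi a).integrableOn (integrable_phi b).integrableOn]

lemma integral_den (a b : ℝ) : ∫ x, den a b x = 1 := by
  have := setIntegral_den Set.univ a b
  rw [setIntegral_univ] at this
  rw [this, gmass, gmass, setIntegral_univ, setIntegral_univ, integral_phi, integral_phi]; norm_num

lemma setIntegral_gap (A : Set ℝ) (a b c d : ℝ) :
    ∫ x in A, gap a b c d x = (∫ x in A, den a b x) - ∫ x in A, den c d x :=
  integral_sub (integrable_den a b).integrableOn (integrable_den c d).integrableOn

/-! ### Total variation distance and the positive set -/

/-- The set where the density of `G_{(a, b)}` exceeds that of `G_{(c, d)}`. -/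
def posSet (a b c d : ℝ) : Set ℝ := {x | 0 < gap a b c d x}

lemma measurableSet_posSet (a b c d : ℝ) : MeasurableSet (posSet a b c d) :=
  measurableSet_lt measurable_const (continuous_gap a b c d).measurable

/-- The total variation distance, as the integral of the positive part. -/
noncomputable def tv (a b c d : ℝ) : ℝ := ∫ x in posSet a b c d, gap a b c d x

lemma tv_eq_integral_max (a b c d : ℝ) : tv a b c d = ∫ x, max (gap a b c d x) 0 := by
  rw [tv, ← integral_indicator (measurableSet_posSet a b c d)]
  congr 1; ext x
  by_cases h : 0 < gap a b c d x
  · rw [Set.indicator_of_mem (show x ∈ posSet a b c d from h), max_eq_left h.le]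
  · rw [Set.indicator_of_notMem (show x ∉ posSet a b c d from h), max_eq_right (not_lt.mp h)]

lemma integrable_max_gap (a b c d : ℝ) : Integrable fun x => max (gap a b c d x) 0 :=
  (integrable_gap a b c d).pos_part

lemma setIntegral_gap_le_tv (A : Set ℝ) (a b c d : ℝ) :
    ∫ x in A, gap a b c d x ≤ tv a b c d := by
  rw [tv_eq_integral_max]
  calc _ ≤ ∫ x in A, max (gap a b c d x) 0 :=
        setIntegral_mono (integrable_gap a b c d).integrableOn
          (integrable_max_gap a b c d).integrableOn fun x => le_max_left _ _
    _ ≤ _ := setIntegral_le_integral (integrable_max_gap a b c d)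
          (ae_of_all _ fun x => le_max_right _ _)

/-- For an optimal set, the nonnegative function `max gap 0 - 1_A * gap` has integral zero, so it
vanishes almost everywhere. Where `gap` is nonzero this decides membership in `A`. -/
lemma ae_eq_posSet_of_tv_le {A : Set ℝ} (hA : MeasurableSet A) {a b c d : ℝ}
    (h : tv a b c d ≤ ∫ x in A, gap a b c d x) (hne : ∃ x, gap a b c d x ≠ 0) :
    A =ᵐ[volume] posSet a b c d := by
  have hint : Integrable (A.indicator (gap a b c d)) := (integrable_gap a b c d).indicator hA
  have hnn : 0 ≤ fun x => max (gap a b c d x) 0 - A.indicator (gap a b c d) x := by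
    intro x
    by_cases hx : x ∈ A
    · simp [hx]
    · simp [hx]
  have h0 : ∫ x, (max (gap a b c d x) 0 - A.indicator (gap a b c d) x) = 0 := by
    refine le_antisymm ?_ (integral_nonneg hnn)
    rw [integral_sub (integrable_max_gap a b c d) hint, integral_indicator hA,
      ← tv_eq_integral_max]
    linarith
  rw [integral_eq_zero_iff_of_nonneg hnn ((integrable_max_gap a b c d).sub hint)] at h0
  have hz : ∀ᵐ x, gap a b c d x ≠ 0 := by
    rw [ae_iff]; simpa using volume_gap_eq_zero hne
  filter_upwards [h0, hz] with x hx hx0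
  apply propext
  change x ∈ A ↔ 0 < gap a b c d x
  by_cases hxA : x ∈ A
  · simp only [hxA, Set.indicator_of_mem, Pi.zero_apply, sub_eq_zero, true_iff] at hx ⊢
    exact lt_of_le_of_ne (max_eq_left_iff.mp hx) hx0.symm
  · simp only [hxA, not_false_eq_true, Set.indicator_of_notMem, Pi.zero_apply, sub_zero,
      false_iff, not_lt] at hx ⊢
    exact max_eq_right_iff.mp hx

lemma integral_mixture (μ : Param) {h : ℝ → ℝ} {B : ℝ} (hm : Measurable h) (hB : ∀ x, |h x| ≤ B) :
    ∫ x, h x ∂(mixture μ) = ∫ x, h x * den (μ 0) (μ 1) x := by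
  have hi : ∀ m : ℝ, Integrable h (gaussianReal m 1) := fun m =>
    Integrable.of_bound hm.aestronglyMeasurable B (ae_of_all _ hB)
  have hi2 : ∀ m : ℝ, Integrable fun x => phi (x - m) * h x := fun m =>
    (integrable_phi m).mul_bdd (c := B) hm.aestronglyMeasurable (ae_of_all _ hB)
  have hg : ∀ m : ℝ, ∫ x, h x ∂(gaussianReal m 1) = ∫ x, phi (x - m) * h x := fun m => by
    rw [integral_gaussianReal_eq_integral_smul one_ne_zero]
    simp_rw [gaussianPDFReal_eq_phi, smul_eq_mul]
  unfold mixture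
  rw [integral_add_measure ((hi _).smul_measure (by simp)) ((hi _).smul_measure (by simp)),
    integral_smul_measure, integral_smul_measure, hg, hg, ← smul_add,
    ← integral_add (hi2 _) (hi2 _)]
  simp only [ENNReal.toReal_inv, ENNReal.toReal_ofNat, smul_eq_mul]
  rw [← integral_const_mul]
  congr 1; ext x; unfold den; ring

lemma mixture_real (μ : Param) {A : Set ℝ} (hA : MeasurableSet A) :
    (mixture μ).real A = ∫ x in A, den (μ 0) (μ 1) x := by
  rw [← integral_indicator_one hA, integral_mixture μ (h := A.indicator 1) (B := 1)
    (measurable_one.indicator hA), ← integral_indicator hA]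
  · congr 1; ext x
    by_cases h : x ∈ A <;> simp [h]
  · intro x
    by_cases h : x ∈ A <;> simp [h]

lemma tvDist_mixture (μs μ : Param) :
    tvDist (mixture μs) (mixture μ) = tv (μs 0) (μs 1) (μ 0) (μ 1) := by
  have h : ∀ A : {A : Set ℝ // MeasurableSet A}, (mixture μs).real A - (mixture μ).real A
      = ∫ x in A, gap (μs 0) (μs 1) (μ 0) (μ 1) x := fun A => by
    rw [mixture_real μs A.2, mixture_real μ A.2, setIntegral_gap]
  unfold tvDist
  simp_rw [h]
  have : Nonempty {A : Set ℝ // MeasurableSet A} := ⟨⟨∅, MeasurableSet.empty⟩⟩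
  refine le_antisymm (ciSup_le fun A => setIntegral_gap_le_tv A _ _ _ _) ?_
  exact le_ciSup (f := fun A : {A : Set ℝ // MeasurableSet A} =>
    ∫ x in (A : Set ℝ), gap (μs 0) (μs 1) (μ 0) (μ 1) x)
    ⟨_, by rintro _ ⟨A, rfl⟩; exact setIntegral_gap_le_tv A _ _ _ _⟩
    ⟨posSet _ _ _ _, measurableSet_posSet _ _ _ _⟩

/-! ### Discriminators, the loss and its gradient -/

/-- The union of the two intervals of a discriminator. -/
def discSet (d : (Fin 2 → EReal) × (Fin 2 → EReal)) : Set ℝ :=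
  {x | d.1 0 ≤ (x : EReal) ∧ (x : EReal) ≤ d.2 0} ∪ {x | d.1 1 ≤ (x : EReal) ∧ (x : EReal) ≤ d.2 1}

lemma measurableSet_between (u v : EReal) : MeasurableSet {x : ℝ | u ≤ (x : EReal) ∧ (x : EReal) ≤ v} :=
  (measurableSet_le measurable_const measurable_coe_real_ereal).inter
    (measurableSet_le measurable_coe_real_ereal measurable_const)

lemma measurableSet_discSet (d : (Fin 2 → EReal) × (Fin 2 → EReal)) : MeasurableSet (discSet d) :=
  (measurableSet_between _ _).union (measurableSet_between _ _)

lemma measurable_discriminator (d : (Fin 2 → EReal) × (Fin 2 → EReal)) :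
    Measurable (discriminator d) := by
  unfold discriminator
  exact Finset.measurable_fun_sum _ fun _ _ =>
    measurable_const.indicator (measurableSet_between _ _)

lemma discriminator_nonneg (d : (Fin 2 → EReal) × (Fin 2 → EReal)) (x : ℝ) :
    0 ≤ discriminator d x :=
  Finset.sum_nonneg fun _ _ => Set.indicator_nonneg (fun _ _ => zero_le_one) _

lemma discriminator_le (d : (Fin 2 → EReal) × (Fin 2 → EReal)) (x : ℝ) : discriminator d x ≤ 2 := by
  calc discriminator d x ≤ ∑ _i : Fin 2, (1 : ℝ) :=
        Finset.sum_le_sum fun _ _ => Set.indicator_le_self' (fun _ _ => zero_le_one) _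
    _ = 2 := by simp

lemma discriminator_ae_eq {d : (Fin 2 → EReal) × (Fin 2 → EReal)} (hd : d ∈ Admissible) :
    discriminator d =ᵐ[volume] (discSet d).indicator 1 := by
  -- The two intervals can meet only at `d.2 0`, where the discriminator may equal 2. For an
  -- infinite endpoint `toReal` is the default 0, and discarding that point is harmless.
  have h0 : ∀ᵐ x : ℝ, x ≠ (d.2 0).toReal := by
    rw [ae_iff]; simp
  filter_upwards [h0] with x hx
  have hdisj : ¬ ((x : EReal) ≤ d.2 0 ∧ d.1 1 ≤ (x : EReal)) := by
    rintro ⟨h1, h2⟩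
    apply hx
    have : (x : EReal) = d.2 0 := le_antisymm h1 (hd.2.1.trans h2)
    rw [← this, EReal.toReal_coe]
  unfold discriminator discSet
  rw [Fin.sum_univ_two]
  by_cases h1 : d.1 0 ≤ (x : EReal) ∧ (x : EReal) ≤ d.2 0
  · have h2 : ¬ (d.1 1 ≤ (x : EReal) ∧ (x : EReal) ≤ d.2 1) := fun h => hdisj ⟨h1.2, h.1⟩
    simp [Set.indicator, h1, h2]
  · by_cases h2 : d.1 1 ≤ (x : EReal) ∧ (x : EReal) ≤ d.2 1
    · simp [Set.indicator, h1, h2]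
    · simp [Set.indicator, h1, h2]

lemma loss_eq (μs μ : Param) {d : (Fin 2 → EReal) × (Fin 2 → EReal)} (hd : d ∈ Admissible) :
    loss μs μ d = (∫ x in discSet d, den (μs 0) (μs 1) x) + 1
      - (gmass (discSet d) (μ 0) + gmass (discSet d) (μ 1)) / 2 := by
  have hb : ∀ x, |discriminator d x| ≤ 2 := fun x => by
    rw [abs_of_nonneg (discriminator_nonneg d x)]; exact discriminator_le d x
  have hb' : ∀ x, |1 - discriminator d x| ≤ 1 := fun x => by
    have := discriminator_nonneg d x
    have := discriminator_le d x
    rw [abs_le]; constructor <;> linarith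
  have hint : ∀ a b : ℝ, ∫ x, discriminator d x * den a b x = ∫ x in discSet d, den a b x := by
    intro a b
    rw [← integral_indicator (measurableSet_discSet d)]
    refine integral_congr_ae ?_
    filter_upwards [discriminator_ae_eq hd] with x hx
    rw [hx]
    by_cases h : x ∈ discSet d <;> simp [h]
  have hi : Integrable fun x => discriminator d x * den (μ 0) (μ 1) x :=
    (integrable_den _ _).bdd_mul (measurable_discriminator d).aestronglyMeasurable
      (ae_of_all _ hb)
  unfold loss
  rw [integral_mixture μs (measurable_discriminator d) hb,
    integral_mixture μ ((measurable_discriminator d).const_sub 1) hb', hint]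
  simp_rw [sub_mul, one_mul]
  rw [integral_sub (integrable_den _ _) hi, hint, integral_den, setIntegral_den _ (μ 0)]
  ring

lemma loss_eq_gap (μs μ : Param) {d : (Fin 2 → EReal) × (Fin 2 → EReal)} (hd : d ∈ Admissible) :
    loss μs μ d = 1 + ∫ x in discSet d, gap (μs 0) (μs 1) (μ 0) (μ 1) x := by
  rw [loss_eq μs μ hd, setIntegral_gap, setIntegral_den _ (μ 0)]; ring

/-- With `d` fixed, each coordinate of `μ` enters through the mass of one component only. The
descent step is thus `η / 2 * gder`, and the two means interact only through the choice of `d`. -/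
lemma gradient_loss (μs μ : Param) {d : (Fin 2 → EReal) × (Fin 2 → EReal)} (hd : d ∈ Admissible)
    (i : Fin 2) :
    gradient (fun ν => loss μs ν d) μ i = -(gder (discSet d) (μ i)) / 2 := by
  have e : (fun ν => loss μs ν d) = fun ν : Param => (∫ x in discSet d, den (μs 0) (μs 1) x) + 1
      - (gmass (discSet d) (ν 0) + gmass (discSet d) (ν 1)) / 2 := by
    ext ν; exact loss_eq μs ν hd
  set A := discSet d
  have hc : ∀ i : Fin 2, HasFDerivAt (fun ν : Param => gmass A (ν i))
      (gder A (μ i) • (EuclideanSpace.proj i : Param →L[ℝ] ℝ)) μ := fun i =>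
    HasDerivAt.comp_hasFDerivAt (f := fun ν : Param => ν i) μ (hasDerivAt_gmass A (μ i))
      (EuclideanSpace.proj i : Param →L[ℝ] ℝ).hasFDerivAt
  have hg : HasGradientAt (fun ν => loss μs ν d)
      (WithLp.toLp 2 fun i => -(gder A (μ i)) / 2 : Param) μ := by
    rw [e, hasGradientAt_iff_hasFDerivAt]
    have := (((hc 0).fun_add (hc 1)).mul_const (2⁻¹ : ℝ)).const_sub
      ((∫ x in A, den (μs 0) (μs 1) x) + 1)
    simp_rw [div_eq_mul_inv]
    refine this.congr_fderiv ?_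
    ext v
    simp [PiLp.inner_apply, Fin.sum_univ_two]
    ring
  rw [hg.gradient]

lemma ordConnected_ae_eq {O : Set ℝ} (hO : O.OrdConnected) (hne : O.Nonempty) :
    (sInf ((↑) '' O : Set EReal)) ≤ sSup ((↑) '' O) ∧
    ({x : ℝ | sInf ((↑) '' O : Set EReal) ≤ (x : EReal) ∧ (x : EReal) ≤ sSup ((↑) '' O)} : Set ℝ)
      =ᵐ[volume] O := by
  set l := sInf ((↑) '' O : Set EReal) with hl
  set u := sSup ((↑) '' O : Set EReal) with hu
  obtain ⟨o, ho⟩ := hne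
  refine ⟨(sInf_le (Set.mem_image_of_mem _ ho)).trans (le_sSup (Set.mem_image_of_mem _ ho)), ?_⟩
  have h0 : ∀ᵐ x : ℝ, x ≠ l.toReal := by rw [ae_iff]; simp
  have h1 : ∀ᵐ x : ℝ, x ≠ u.toReal := by rw [ae_iff]; simp
  filter_upwards [h0, h1] with x hx0 hx1
  apply propext
  change (l ≤ (x : EReal) ∧ (x : EReal) ≤ u) ↔ x ∈ O
  constructor
  · rintro ⟨ha, hb⟩
    have ha' : l < x := lt_of_le_of_ne ha (by
      intro h; apply hx0; rw [h, EReal.toReal_coe])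
    have hb' : (x : EReal) < u := lt_of_le_of_ne hb (by
      intro h; apply hx1; rw [← h, EReal.toReal_coe])
    obtain ⟨_, ⟨p, hp, rfl⟩, hpx⟩ := sInf_lt_iff.mp ha'
    obtain ⟨_, ⟨q, hq, rfl⟩, hqx⟩ := lt_sSup_iff.mp hb'
    exact hO.out hp hq ⟨(EReal.coe_lt_coe_iff.mp hpx).le, (EReal.coe_lt_coe_iff.mp hqx).le⟩
  · intro h
    exact ⟨sInf_le (Set.mem_image_of_mem _ h), le_sSup (Set.mem_image_of_mem _ h)⟩

/-- The positive set of a difference of mixtures is a.e. the set of a discriminator. -/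
lemma exists_admissible_ae_eq (a b c d : ℝ) :
    ∃ D ∈ Admissible, discSet D =ᵐ[volume] posSet a b c d := by
  set O := posSet a b c d with hOdef
  by_cases hO : O.OrdConnected
  · rcases O.eq_empty_or_nonempty with he | hne
    -- The degenerate intervals `[⊥, ⊥]` and `[⊤, ⊤]` contain no real number; below, `[⊤, ⊤]` also
    -- fills the unused second slot.
    · refine ⟨(![⊥, ⊤], ![⊥, ⊤]), by simp [Admissible], ?_⟩
      rw [he]
      refine Filter.EventuallyEq.of_eq ?_
      ext x; simp [discSet]
    · obtain ⟨h1, h2⟩ := ordConnected_ae_eq hO hne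
      refine ⟨(![sInf ((↑) '' O), ⊤], ![sSup ((↑) '' O), ⊤]), ⟨by simpa using h1, by simp,
        by simp⟩, ?_⟩
      refine Filter.EventuallyEq.trans (Filter.EventuallyEq.of_eq ?_) h2
      ext x; simp [discSet]
  · obtain ⟨p, hp, s, hs, q, hq, hqO⟩ : ∃ p ∈ O, ∃ s ∈ O, ∃ q ∈ Set.Icc p s, q ∉ O := by
      by_contra! h
      exact hO ⟨fun p hp s hs q hq => h p hp s hs q hq⟩
    have hpq : p < q := lt_of_le_of_ne hq.1 (by rintro rfl; exact hqO hp)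
    have hqs : q < s := lt_of_le_of_ne hq.2 (by rintro rfl; exact hqO hs)
    have hlt : ∀ {x y : ℝ}, x ∈ O → y ∉ O → x ≤ y → x < y := fun hx hy h =>
      lt_of_le_of_ne h (by rintro rfl; exact hy hx)
    have hgt : ∀ {x y : ℝ}, x ∈ O → y ∉ O → y ≤ x → y < x := fun hx hy h =>
      lt_of_le_of_ne h (by rintro rfl; exact hy hx)
    have hnot : ∀ {y : ℝ}, y ∉ O → gap a b c d y ≤ 0 := fun hy => not_lt.mp hy
    -- A second hole on either side of `q` would produce the sign pattern + - + - +, which four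
    -- exponentials cannot have.
    have hO1 : (O ∩ Set.Iio q).OrdConnected := by
      refine ⟨fun x hx z hz y hy => ?_⟩
      refine ⟨?_, hy.2.trans_lt hz.2⟩
      by_contra hyO
      exact gap_not_alternating a b c d (hlt hx.1 hyO hy.1) (hgt hz.1 hyO hy.2) hz.2 hqs hx.1
        (hnot hyO) hz.1 (hnot hqO) hs
    have hO2 : (O ∩ Set.Ioi q).OrdConnected := by
      refine ⟨fun x hx z hz y hy => ?_⟩
      refine ⟨?_, hx.2.trans_le hy.1⟩
      by_contra hyO
      exact gap_not_alternating a b c d hpq hx.2 (hlt hx.1 hyO hy.1) (hgt hz.1 hyO hy.2) hp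
        (hnot hqO) hx.1 (hnot hyO) hz.1
    obtain ⟨h1, e1⟩ := ordConnected_ae_eq hO1 ⟨p, hp, hpq⟩
    obtain ⟨h2, e2⟩ := ordConnected_ae_eq hO2 ⟨s, hs, hqs⟩
    have h3 : sSup ((↑) '' (O ∩ Set.Iio q) : Set EReal) ≤ sInf ((↑) '' (O ∩ Set.Ioi q)) := by
      refine (sSup_le (a := (q : EReal)) ?_).trans (le_sInf ?_)
      · rintro _ ⟨x, hx, rfl⟩; exact EReal.coe_le_coe_iff.mpr hx.2.le
      · rintro _ ⟨x, hx, rfl⟩; exact EReal.coe_le_coe_iff.mpr hx.2.le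
    refine ⟨(![sInf (Real.toEReal '' (O ∩ Set.Iio q)), sInf (Real.toEReal '' (O ∩ Set.Ioi q))],
      ![sSup (Real.toEReal '' (O ∩ Set.Iio q)), sSup (Real.toEReal '' (O ∩ Set.Ioi q))]), ⟨h1, h3, h2⟩, ?_⟩
    have e : O ∩ Set.Iio q ∪ O ∩ Set.Ioi q = O := by
      rw [← Set.inter_union_distrib_left]
      ext x
      simp only [Set.mem_inter_iff, Set.mem_union, Set.mem_Iio, Set.mem_Ioi]
      refine ⟨fun h => h.1, fun h => ⟨h, lt_or_gt_of_ne ?_⟩⟩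
      rintro rfl; exact hqO h
    have := ae_eq_set_union e1 e2
    rwa [e] at this

lemma exists_isOptimalDiscriminator (μs μ : Param) : ∃ d, IsOptimalDiscriminator μs μ d := by
  obtain ⟨D, hD, e⟩ := exists_admissible_ae_eq (μs 0) (μs 1) (μ 0) (μ 1)
  refine ⟨D, hD, fun d' hd' => ?_⟩
  rw [loss_eq_gap μs μ hD, loss_eq_gap μs μ hd', setIntegral_congr_set e]
  have := setIntegral_gap_le_tv (discSet d') (μs 0) (μs 1) (μ 0) (μ 1)
  unfold tv at this
  linarith

/-- This is what makes the choice of maximizer immaterial: the gradient sees its set only up to null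
sets. When `gap` vanishes identically every admissible discriminator is optimal, hence the
nonvanishing hypothesis. -/
lemma IsOptimalDiscriminator.ae_eq {μs μ : Param} {d : (Fin 2 → EReal) × (Fin 2 → EReal)}
    (h : IsOptimalDiscriminator μs μ d) (hne : ∃ x, gap (μs 0) (μs 1) (μ 0) (μ 1) x ≠ 0) :
    discSet d =ᵐ[volume] posSet (μs 0) (μs 1) (μ 0) (μ 1) := by
  obtain ⟨D, hD, e⟩ := exists_admissible_ae_eq (μs 0) (μs 1) (μ 0) (μ 1)
  refine ae_eq_posSet_of_tv_le (measurableSet_discSet d) ?_ hne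
  have := h.2 D hD
  rw [loss_eq_gap μs μ hD, loss_eq_gap μs μ h.1, setIntegral_congr_set e] at this
  unfold tv
  linarith

/-! ### Elementary bounds and symmetries -/

lemma phi_le_one (y : ℝ) : phi y ≤ 1 :=
  (phi_le_exp y).trans (Real.exp_le_one_iff.mpr (by nlinarith [sq_nonneg y]))

lemma den_le_one (a b x : ℝ) : den a b x ≤ 1 := by
  have := phi_le_one (x - a); have := phi_le_one (x - b); unfold den; linarith

lemma abs_gap_le_one (a b c d x : ℝ) : |gap a b c d x| ≤ 1 := by
  have := den_le_one a b x; have := den_le_one c d x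
  have := den_pos a b x; have := den_pos c d x
  unfold gap; rw [abs_le]; constructor <;> linarith

lemma posSet_neg (a b c d : ℝ) : posSet (-a) (-b) (-c) (-d) = Neg.neg ⁻¹' posSet a b c d := by
  ext x
  change 0 < gap (-a) (-b) (-c) (-d) x ↔ 0 < gap a b c d (-x)
  have := gap_neg a b c d (-x)
  rw [neg_neg] at this
  rw [this]

lemma gder_posSet_neg (a b c d m : ℝ) :
    gder (posSet (-a) (-b) (-c) (-d)) (-m) = -gder (posSet a b c d) m := by
  rw [posSet_neg, gder_neg]

lemma posSet_comm_left (a b c d : ℝ) : posSet b a c d = posSet a b c d := by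
  unfold posSet; rw [gap_comm_left]

lemma posSet_comm_right (a b c d : ℝ) : posSet a b d c = posSet a b c d := by
  unfold posSet; rw [gap_comm_right]

lemma tv_comm_left (a b c d : ℝ) : tv b a c d = tv a b c d := by
  unfold tv; rw [posSet_comm_left, gap_comm_left]

lemma tv_comm_right (a b c d : ℝ) : tv a b d c = tv a b c d := by
  unfold tv; rw [posSet_comm_right, gap_comm_right]

lemma tv_swap (a b c d : ℝ) : tv c d a b = tv a b c d := by
  have h : ∫ x, gap a b c d x = 0 := by
    have := setIntegral_gap Set.univ a b c d
    simp only [setIntegral_univ, integral_den, sub_self] at this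
    exact this
  have e : ∀ x, gap a b c d x = max (gap a b c d x) 0 - max (gap c d a b x) 0 := fun x => by
    rw [gap_swap a b c d]; grind
  rw [tv_eq_integral_max, tv_eq_integral_max]
  have h2 := integral_sub (integrable_max_gap a b c d) (integrable_max_gap c d a b)
  simp_rw [← e] at h2
  linarith

lemma gap_ne_zero_of_tv_pos {a b c d : ℝ} (h : 0 < tv a b c d) : ∃ x, gap a b c d x ≠ 0 := by
  by_contra! h0
  simp [tv, h0] at h

/-! ### Lower bound for the gradient -/

lemma gder_nonpos_of_subset {S : Set ℝ} (hS : MeasurableSet S) {m : ℝ} (h : S ⊆ Set.Iic m) :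
    gder S m ≤ 0 :=
  setIntegral_nonpos hS fun _ hx =>
    mul_nonpos_of_nonpos_of_nonneg (sub_nonpos.mpr (h hx)) (phi_pos _).le

/-- Left of `m` the integrand is nonpositive, so there is no cancellation, and the half-line
contained in `S` alone gives the bound. -/
lemma gder_le_of_subset {S : Set ℝ} (hS : MeasurableSet S) {m z : ℝ} (h : S ⊆ Set.Iic m)
    (hz : ∀ᵐ x, x ≤ z → x ∈ S) : gder S m ≤ -phi (z - m) := by
  rw [← gder_Iic]
  unfold gder
  rw [← integral_indicator hS, ← integral_indicator measurableSet_Iic]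
  refine integral_mono_ae ((integrable_psi m).indicator hS)
    ((integrable_psi m).indicator measurableSet_Iic) ?_
  filter_upwards [hz] with x hx
  by_cases h1 : x ≤ z
  · simp [hx h1, h1]
  · by_cases h2 : x ∈ S
    · have h3 : x - m ≤ 0 := sub_nonpos.mpr (h h2)
      simp only [h2, Set.indicator_of_mem, Set.mem_Iic, h1, not_false_eq_true,
        Set.indicator_of_notMem]
      exact mul_nonpos_of_nonpos_of_nonneg h3 (phi_pos _).le
    · simp [h1, h2]

/-- Gradient bound when the generator lies to the right of the truth. -/
lemma gder_posSet_le {a b c d : ℝ} (hab : a ≤ b) (hcd : c ≤ d) (hac : a ≤ c) (hbd : b ≤ d)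
    (hne : ∃ x, gap a b c d x ≠ 0) : gder (posSet a b c d) d ≤ -phi (a - d) := by
  -- Right of `d` each component of the truth is at least as far away as its counterpart in the
  -- generator; left of `a` it is at least as near. So `posSet` lies left of `d` and contains almost
  -- all of the half-line up to `a`.
  refine gder_le_of_subset (measurableSet_posSet a b c d) ?_ ?_
  · intro x hx
    by_contra hxd
    have hxd : d < x := not_le.mp hxd
    have h1 : phi (x - a) ≤ phi (x - c) := phi_le_phi (by
      rw [abs_of_nonneg (by linarith), abs_of_nonneg (by linarith)]; linarith)
    have h2 : phi (x - b) ≤ phi (x - d) := phi_le_phi (by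
      rw [abs_of_nonneg (by linarith), abs_of_nonneg (by linarith)]; linarith)
    have : 0 < gap a b c d x := hx
    unfold gap den at this; linarith
  · have hz : ∀ᵐ x, gap a b c d x ≠ 0 := by
      rw [ae_iff]; simpa using volume_gap_eq_zero hne
    filter_upwards [hz] with x hx hxa
    have h1 : phi (x - c) ≤ phi (x - a) := phi_le_phi (by
      rw [abs_of_nonpos (by linarith), abs_of_nonpos (by linarith)]; linarith)
    have h2 : phi (x - d) ≤ phi (x - b) := phi_le_phi (by
      rw [abs_of_nonpos (by linarith), abs_of_nonpos (by linarith)]; linarith)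
    refine lt_of_le_of_ne ?_ hx.symm
    unfold gap den; linarith

/-- Gradient bound when the generator lies to the left of the truth. -/
lemma le_gder_posSet {a b c d : ℝ} (hab : a ≤ b) (hcd : c ≤ d) (hca : c ≤ a) (hdb : d ≤ b)
    (hne : ∃ x, gap a b c d x ≠ 0) : phi (b - c) ≤ gder (posSet a b c d) c := by
  have h := gder_posSet_le (a := -b) (b := -a) (c := -d) (d := -c) (by linarith) (by linarith)
    (by linarith) (by linarith) (by
      obtain ⟨x, hx⟩ := hne
      refine ⟨-x, ?_⟩
      rwa [gap_comm_left, gap_comm_right, gap_neg])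
  rw [posSet_comm_left, posSet_comm_right, gder_posSet_neg, ← phi_neg] at h
  rw [show -(-b - -c) = b - c by ring] at h
  linarith

/-- If the truth is nested inside the generator, then the positive set is an interval. -/
lemma ordConnected_posSet {a b c d : ℝ} (hca : c < a) (hab : a ≤ b) (hbd : b < d) :
    (posSet a b c d).OrdConnected := by
  -- `U` is `gap` up to a positive factor that makes the `b` term constant. Its derivative `V`,
  -- multiplied by `exp ((b - c) * x)`, is nonincreasing by `hW`. So `U` cannot decrease first and
  -- increase later, as it would around a hole in the positive set.
  set U : ℝ → ℝ := fun x => Real.exp (-a ^ 2 / 2) * Real.exp ((a - b) * x) + Real.exp (-b ^ 2 / 2)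
    - Real.exp (-c ^ 2 / 2) * Real.exp ((c - b) * x)
    - Real.exp (-d ^ 2 / 2) * Real.exp ((d - b) * x) with hU
  set V : ℝ → ℝ := fun x => Real.exp (-a ^ 2 / 2) * (a - b) * Real.exp ((a - b) * x)
    - Real.exp (-c ^ 2 / 2) * (c - b) * Real.exp ((c - b) * x)
    - Real.exp (-d ^ 2 / 2) * (d - b) * Real.exp ((d - b) * x) with hV
  have hexp : ∀ k x : ℝ, HasDerivAt (fun x => Real.exp (k * x)) (k * Real.exp (k * x)) x :=
    fun k x => (((hasDerivAt_id x).const_mul k).exp).congr_deriv (by simp; ring)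
  have hd : ∀ x, HasDerivAt U (V x) x := fun x =>
    ((((hexp (a - b) x).const_mul _).add_const _).fun_sub ((hexp (c - b) x).const_mul _)).fun_sub
      ((hexp (d - b) x).const_mul _) |>.congr_deriv (by simp only [hV]; ring)
  have hgap : ∀ x, gap a b c d x = phi x * Real.exp (b * x) / 2 * U x := by
    intro x
    have h : ∀ m : ℝ, phi (x - m)
        = phi x * Real.exp (b * x) * (Real.exp (-m ^ 2 / 2) * Real.exp ((m - b) * x)) := by
      intro m
      rw [phi_eq_exp_mul, mul_assoc, ← Real.exp_add, ← Real.exp_add]; congr 2; ring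
    simp only [gap, den, h, hU]
    simp only [sub_self, zero_mul, Real.exp_zero]
    ring
  have hpos : ∀ x, 0 < phi x * Real.exp (b * x) / 2 := fun x => by
    have := phi_pos x; positivity
  refine ⟨fun p hp q hq y hy => ?_⟩
  by_contra hyS
  have hUp : 0 < U p := by
    have : 0 < gap a b c d p := hp
    rw [hgap] at this
    exact (mul_pos_iff_of_pos_left (hpos p)).mp this
  have hUq : 0 < U q := by
    have : 0 < gap a b c d q := hq
    rw [hgap] at this
    exact (mul_pos_iff_of_pos_left (hpos q)).mp this
  have hUy : U y ≤ 0 := by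
    by_contra h
    apply hyS
    change 0 < gap a b c d y
    rw [hgap]
    exact mul_pos (hpos y) (not_le.mp h)
  have hpy : p < y := lt_of_le_of_ne hy.1 (by rintro rfl; exact hyS hp)
  have hyq : y < q := lt_of_le_of_ne hy.2 (by rintro rfl; exact hyS hq)
  have hcont : ∀ s, ContinuousOn U s := fun s x _ => (hd x).continuousAt.continuousWithinAt
  obtain ⟨ξ, hξ, e1⟩ := exists_hasDerivAt_eq_slope U V hpy (hcont _) (fun x _ => hd x)
  obtain ⟨ζ, hζ, e2⟩ := exists_hasDerivAt_eq_slope U V hyq (hcont _) (fun x _ => hd x)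
  have h1 : V ξ < 0 := by rw [e1]; exact div_neg_of_neg_of_pos (by linarith) (by linarith)
  have h2 : 0 < V ζ := by rw [e2]; exact div_pos (by linarith) (by linarith)
  have hW : ∀ x, V x * Real.exp ((b - c) * x) = Real.exp (-c ^ 2 / 2) * (b - c)
      - (Real.exp (-a ^ 2 / 2) * (b - a) * Real.exp ((a - c) * x)
      + Real.exp (-d ^ 2 / 2) * (d - b) * Real.exp ((d - c) * x)) := by
    intro x
    have e : ∀ k : ℝ, Real.exp ((k - c) * x) = Real.exp ((k - b) * x) * Real.exp ((b - c) * x) := by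
      intro k; rw [← Real.exp_add]; ring_nf
    have e0 := e c
    simp only [sub_self, zero_mul, Real.exp_zero] at e0
    rw [e a, e d]
    simp only [hV]
    linear_combination (Real.exp (-c ^ 2 / 2) * (c - b)) * e0
  have hlt : ξ ≤ ζ := (hξ.2.trans hζ.1).le
  have hanti : V ζ * Real.exp ((b - c) * ζ) ≤ V ξ * Real.exp ((b - c) * ξ) := by
    rw [hW, hW]
    have i1 : Real.exp ((a - c) * ξ) ≤ Real.exp ((a - c) * ζ) :=
      Real.exp_le_exp.mpr (mul_le_mul_of_nonneg_left hlt (by linarith))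
    have i2 : Real.exp ((d - c) * ξ) ≤ Real.exp ((d - c) * ζ) :=
      Real.exp_le_exp.mpr (mul_le_mul_of_nonneg_left hlt (by linarith))
    have i3 : 0 ≤ Real.exp (-a ^ 2 / 2) * (b - a) :=
      mul_nonneg (Real.exp_pos _).le (by linarith)
    have i4 : 0 ≤ Real.exp (-d ^ 2 / 2) * (d - b) :=
      mul_nonneg (Real.exp_pos _).le (by linarith)
    have := mul_le_mul_of_nonneg_left i1 i3
    have := mul_le_mul_of_nonneg_left i2 i4
    linarith
  have h3 := mul_neg_of_neg_of_pos h1 (Real.exp_pos ((b - c) * ξ))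
  have h4 := mul_pos h2 (Real.exp_pos ((b - c) * ζ))
  linarith

lemma half_le_abs_one_sub_exp {t s : ℝ} (hs : 0 ≤ s) (hs1 : s ≤ 1) (h : s ≤ |t|) :
    s / 2 ≤ |1 - Real.exp (-t)| := by
  rcases le_abs.mp h with h | h
  · have h1 : Real.exp (-t) ≤ Real.exp (-s) := by gcongr
    have h2 : Real.exp (-s) * Real.exp s = 1 := by rw [← Real.exp_add]; simp
    have h3 := Real.add_one_le_exp s
    have h4 := Real.exp_pos (-s)
    have : Real.exp (-s) ≤ 1 - s / 2 := by nlinarith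
    exact le_trans (by linarith) (le_abs_self _)
  · have := Real.add_one_le_exp (-t)
    rw [abs_sub_comm]
    exact le_trans (by linarith) (le_abs_self _)

/-- On an interval from `z` to `u` the value at `m` is `phi (z - m) - phi (u - m)`, which is small
only if `m` is near the midpoint; two points at distance `s` cannot both be. The outside point `w`
left of `p` keeps the left endpoint in `[-R, R]`. A half-line has a single boundary term and no
cancellation. -/
lemma le_abs_gder_interval_aux {J : Set ℝ} (hJ : J.OrdConnected) {R M p q w l s m₁ m₂ : ℝ}
    (hp : p ∈ J) (hq : q ∈ J) (hw : w ∉ J) (hpR : |p| ≤ R) (hwR : |w| ≤ R) (hwp : w < p)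
    (hl : 0 < l) (hpq : p + l ≤ q) (hs : 0 < s) (hls : l * s ≤ 2) (hm₁ : |m₁| ≤ M) (hm₂ : |m₂| ≤ M)
    (hmm : s ≤ |m₁ - m₂|) :
    phi (R + M) * (l * s) / 4 ≤ |gder J m₁| ∨ phi (R + M) * (l * s) / 4 ≤ |gder J m₂| := by
  have hlb : ∀ x ∈ J, w ≤ x := fun x hx => by
    by_contra h
    exact hw (hJ.out hx hp ⟨(not_le.mp h).le, hwp.le⟩)
  have hbdd : BddBelow J := ⟨w, hlb⟩
  set z := sInf J with hz
  have hz1 : w ≤ z := le_csInf ⟨p, hp⟩ hlb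
  have hz2 : z ≤ p := csInf_le hbdd hp
  have hzR : |z| ≤ R := by
    rw [abs_le] at *; constructor <;> linarith [hpR.2, hwR.1]
  have hphi : ∀ m, |m| ≤ M → phi (R + M) ≤ phi (z - m) := fun m hm =>
    phi_le_phi ((abs_sub z m).trans ((add_le_add hzR hm).trans (le_abs_self _)))
  have hp0 := phi_pos (R + M)
  by_cases hub : BddAbove J
  · set u := sSup J with hu
    have hqu : q ≤ u := le_csSup hub hq
    have hJe : J =ᵐ[volume] Set.Icc z u := by
      refine Filter.EventuallyLE.antisymm (Filter.Eventually.of_forall fun x hx =>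
        ⟨csInf_le hbdd hx, le_csSup hub hx⟩) ?_
      refine (Ioo_ae_eq_Icc (μ := volume) (a := z) (b := u)).symm.le.trans
        (Filter.Eventually.of_forall fun x hx => ?_)
      obtain ⟨y, hy, hyx⟩ := exists_lt_of_csInf_lt ⟨p, hp⟩ hx.1
      obtain ⟨y', hy', hyx'⟩ := exists_lt_of_lt_csSup ⟨p, hp⟩ hx.2
      exact hJ.out hy hy' ⟨hyx.le, hyx'.le⟩
    have hzu : l ≤ u - z := by linarith
    have key : ∀ m, |m| ≤ M → s ≤ |z + u - 2 * m| → phi (R + M) * (l * s) / 4 ≤ |gder J m| := by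
      intro m hm hsm
      rw [gder_congr hJe, gder_Icc (by linarith)]
      have e : phi (u - m) = phi (z - m) * Real.exp (-((u - z) * (z + u - 2 * m) / 2)) := by
        unfold phi
        rw [mul_assoc, ← Real.exp_add]; congr 2; ring
      have h1 : l * s / 2 ≤ |(u - z) * (z + u - 2 * m) / 2| := by
        rw [abs_div, abs_mul, abs_of_pos (show 0 < u - z by linarith), abs_two]
        have : 0 ≤ u - z := by linarith
        gcongr
      have h2 := half_le_abs_one_sub_exp (by positivity) (by linarith) h1
      rw [e, ← mul_one_sub, abs_mul, abs_of_pos (phi_pos _)]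
      calc phi (R + M) * (l * s) / 4 = phi (R + M) * (l * s / 2 / 2) := by ring
        _ ≤ _ := mul_le_mul (hphi m hm) h2 (by positivity) (phi_pos _).le
    by_cases h1 : s ≤ |z + u - 2 * m₁|
    · exact Or.inl (key m₁ hm₁ h1)
    · refine Or.inr (key m₂ hm₂ ?_)
      rw [not_le] at h1
      have h2 : 2 * (m₁ - m₂) = (z + u - 2 * m₂) - (z + u - 2 * m₁) := by ring
      have h3 : 2 * |m₁ - m₂| ≤ |z + u - 2 * m₂| + |z + u - 2 * m₁| := by
        rw [← abs_two, ← abs_mul, abs_two, h2]; exact abs_sub _ _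
      linarith
  · left
    have hJe : J =ᵐ[volume] Set.Ioi z := by
      have hJz : J ≤ᵐ[volume] Set.Ici z :=
        Filter.Eventually.of_forall fun x hx => csInf_le hbdd hx
      refine Filter.EventuallyLE.antisymm
        (hJz.trans (Ioi_ae_eq_Ici (μ := volume) (a := z)).symm.le)
        (Filter.Eventually.of_forall fun x hx => ?_)
      obtain ⟨y, hy, hyx⟩ := exists_lt_of_csInf_lt ⟨p, hp⟩ (show sInf J < x from hx)
      obtain ⟨y', hy', hyx'⟩ := not_bddAbove_iff.mp hub x
      exact hJ.out hy hy' ⟨hyx.le, hyx'.le⟩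
    rw [gder_congr hJe, gder_Ioi, abs_of_pos (phi_pos _)]
    refine le_trans ?_ (hphi m₁ hm₁)
    nlinarith

/-- For an interval of length at least `l` with an endpoint in `[-R, R]`, the functional `gder`
cannot be small at two separated points. -/
lemma le_abs_gder_interval {J : Set ℝ} (hJ : J.OrdConnected) {R M p q w l s m₁ m₂ : ℝ}
    (hp : p ∈ J) (hq : q ∈ J) (hw : w ∉ J) (hpR : |p| ≤ R) (hqR : |q| ≤ R) (hwR : |w| ≤ R)
    (hl : 0 < l) (hpq : p + l ≤ q) (hs : 0 < s) (hls : l * s ≤ 2) (hm₁ : |m₁| ≤ M) (hm₂ : |m₂| ≤ M)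
    (hmm : s ≤ |m₁ - m₂|) :
    phi (R + M) * (l * s) / 4 ≤ |gder J m₁| ∨ phi (R + M) * (l * s) / 4 ≤ |gder J m₂| := by
  by_cases hwp : w < p
  · exact le_abs_gder_interval_aux hJ hp hq hw hpR hwR hwp hl hpq hs hls hm₁ hm₂ hmm
  · have hqw : q < w := by
      by_contra h
      exact hw (hJ.out hp hq ⟨not_lt.mp hwp, not_lt.mp h⟩)
    have hJ' : (Neg.neg ⁻¹' J : Set ℝ).OrdConnected :=
      ⟨fun x hx y hy z hz => hJ.out hy hx ⟨neg_le_neg hz.2, neg_le_neg hz.1⟩⟩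
    have := le_abs_gder_interval_aux hJ' (R := R) (M := M) (p := -q) (q := -p) (w := -w) (l := l)
      (s := s) (m₁ := -m₁) (m₂ := -m₂) (by simpa using hq) (by simpa using hp) (by simpa using hw)
      (by simpa using hqR) (by simpa using hwR) (by linarith) hl (by linarith) hs hls
      (by simpa using hm₁) (by simpa using hm₂)
      (by rw [← abs_neg, neg_sub_neg, neg_sub]; exact hmm)
    simpa only [gder_neg, abs_neg] using this

lemma setIntegral_gap_tail_le {a b c d M R : ℝ} (ha : |a| ≤ M) (hb : |b| ≤ M) (hMR : M ≤ R)
    {A : Set ℝ} (hA : MeasurableSet A) (hAR : ∀ x ∈ A, R ≤ |x|) :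
    ∫ x in A, gap a b c d x ≤ 6 * Real.exp (-(R - M) ^ 2 / 8) := by
  have h : ∀ m : ℝ, |m| ≤ M → gmass A m ≤ 6 * Real.exp (-(R - M) ^ 2 / 8) := fun m hm =>
    (le_abs_self _).trans (abs_setIntegral_le_tail hm hMR (fun x => by
      rw [abs_of_pos (phi_pos _)]; exact phi_le_exp _) hA hAR)
  rw [setIntegral_gap, setIntegral_den _ a]
  have h0 : 0 ≤ ∫ x in A, den c d x := setIntegral_nonneg hA fun x _ => (den_pos c d x).le
  have := h a ha
  have := h b hb
  linarith

lemma tv_le_inside_add_tail {a b c d M R : ℝ} (ha : |a| ≤ M) (hb : |b| ≤ M) (hMR : M ≤ R) :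
    tv a b c d ≤ (∫ x in posSet a b c d ∩ Set.Icc (-R) R, gap a b c d x)
      + 6 * Real.exp (-(R - M) ^ 2 / 8) := by
  rw [tv, ← integral_inter_add_sdiff (measurableSet_Icc (a := -R) (b := R))
    (integrable_gap a b c d).integrableOn]
  gcongr
  refine setIntegral_gap_tail_le ha hb hMR
    ((measurableSet_posSet a b c d).diff measurableSet_Icc) fun x hx => ?_
  by_contra h
  exact hx.2 (abs_le.mp (not_le.mp h).le)

lemma setIntegral_inside_le {u : ℝ → ℝ} {K : ℝ} {A : Set ℝ} {v : ℝ} (hv : 0 ≤ v) (hK : 0 ≤ K)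
    (hAv : volume A ≤ ENNReal.ofReal v) (hu : ∀ x ∈ A, |u x| ≤ K) :
    |∫ x in A, u x| ≤ K * v := by
  have h1 := norm_setIntegral_le_of_norm_le_const (f := u) (s := A) (C := K)
    (hAv.trans_lt ENNReal.ofReal_lt_top) hu
  refine h1.trans ?_
  gcongr
  exact ENNReal.toReal_le_of_le_ofReal hv hAv

/-- Points witnessing that the positive set is not too small inside `[-R, R]`. -/
lemma exists_pair_of_tv {a b c d M R l : ℝ} (ha : |a| ≤ M) (hb : |b| ≤ M) (hMR : M ≤ R)
    (hl : 0 < l) (h : 2 * l + 6 * Real.exp (-(R - M) ^ 2 / 8) < tv a b c d) :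
    ∃ p ∈ posSet a b c d, ∃ q ∈ posSet a b c d, |p| ≤ R ∧ |q| ≤ R ∧ p + l ≤ q := by
  by_contra! hcon
  -- Without such a pair everything lies within `l` of one point; as `gap` is at most 1, this and
  -- the tail leave too little mass for the distance.
  have hvol : volume (posSet a b c d ∩ Set.Icc (-R) R) ≤ ENNReal.ofReal (2 * l) := by
    rcases (posSet a b c d ∩ Set.Icc (-R) R).eq_empty_or_nonempty with he | ⟨p, hp⟩
    · rw [he]; simp
    · calc _ ≤ volume (Set.Icc (p - l) (p + l)) := measure_mono fun q hq => by
            have h1 := hcon p hp.1 q hq.1 (abs_le.mpr hp.2) (abs_le.mpr hq.2)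
            have h2 := hcon q hq.1 p hp.1 (abs_le.mpr hq.2) (abs_le.mpr hp.2)
            constructor <;> linarith
        _ = _ := by rw [Real.volume_Icc]; congr 1; ring
  have h1 := tv_le_inside_add_tail (c := c) (d := d) ha hb hMR
  have h2 := setIntegral_inside_le (u := gap a b c d) (K := 1) (v := 2 * l) (by positivity)
    zero_le_one hvol (fun x _ => abs_gap_le_one a b c d x)
  have h3 := le_abs_self (∫ x in posSet a b c d ∩ Set.Icc (-R) R, gap a b c d x)
  linarith

/-- The interval case of the gradient bound. -/
lemma le_abs_gder_posSet_nested {a b c d M R l s m₁ m₂ : ℝ} (hJ : (posSet a b c d).OrdConnected)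
    (ha : |a| ≤ M) (hb : |b| ≤ M) (hc : |c| ≤ M) (hd : |d| ≤ M) (hMR : M ≤ R)
    (hl : 0 < l) (h : 2 * l + 6 * Real.exp (-(R - M) ^ 2 / 8) < tv a b c d)
    (hs : 0 < s) (hls : l * s ≤ 2) (hm₁ : |m₁| ≤ M) (hm₂ : |m₂| ≤ M) (hmm : s ≤ |m₁ - m₂|) :
    phi (R + M) * (l * s) / 4 ≤ |gder (posSet a b c d) m₁| ∨
      phi (R + M) * (l * s) / 4 ≤ |gder (posSet a b c d) m₂| := by
  obtain ⟨p, hp, q, hq, hpR, hqR, hpq⟩ := exists_pair_of_tv ha hb hMR hl h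
  -- The distance is symmetric, so exchanging truth and generator yields a point outside `posSet`
  -- within `[-R, R]`.
  obtain ⟨w, hw, -, -, hwR, -⟩ := exists_pair_of_tv (a := c) (b := d) (c := a) (d := b) hc hd hMR hl
    (by rwa [tv_swap])
  refine le_abs_gder_interval hJ hp hq (w := w) ?_ hpR hqR hwR hl hpq hs hls hm₁ hm₂ hmm
  intro h1
  have h2 : 0 < gap a b c d w := h1
  have h3 : 0 < gap c d a b w := hw
  rw [gap_swap] at h3
  linarith

/-- The two positive sets are complementary almost everywhere, and the whole line contributes zero.
This reduces a generator nested in the truth to the interval case. -/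
lemma gder_posSet_swap {a b c d : ℝ} (hne : ∃ x, gap a b c d x ≠ 0) (m : ℝ) :
    gder (posSet c d a b) m = -gder (posSet a b c d) m := by
  rw [← gder_compl (measurableSet_posSet a b c d)]
  refine gder_congr ?_ m
  have hz : ∀ᵐ x, gap a b c d x ≠ 0 := by
    rw [ae_iff]; simpa using volume_gap_eq_zero hne
  filter_upwards [hz] with x hx
  apply propext
  change 0 < gap c d a b x ↔ ¬ 0 < gap a b c d x
  rw [gap_swap]
  grind

lemma exp_neg_nat_mul (k : ℕ) (r : ℝ) : Real.exp (-(k * r ^ 2)) = Real.exp (-r ^ 2) ^ k := by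
  rw [← Real.exp_nat_mul]; congr 1; ring

lemma exp_neg_sq_le {r : ℝ} (hr : 10 ≤ r) : Real.exp (-r ^ 2) * 100 ≤ 1 := by
  have h1 := Real.add_one_le_exp (r ^ 2)
  have h2 : Real.exp (-r ^ 2) * Real.exp (r ^ 2) = 1 := by rw [← Real.exp_add]; simp
  have := Real.exp_pos (-r ^ 2)
  nlinarith

/-- Lower bound for the gradient away from the optimum. -/
theorem exists_le_abs_gder {r a b c d : ℝ} (hr : 10 ≤ r) (hab : a ≤ b) (hcd : c ≤ d)
    (ha : |a| ≤ 2 * r) (hb : |b| ≤ 2 * r) (hc : |c| ≤ 2 * r) (hd : |d| ≤ 2 * r)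
    (hs : Real.exp (-r ^ 2) ^ 8 ≤ d - c) (htv : Real.exp (-r ^ 2) / 2 ≤ tv a b c d) :
    Real.exp (-r ^ 2) ^ 90 ≤ |gder (posSet a b c d) c| ∨
      Real.exp (-r ^ 2) ^ 90 ≤ |gder (posSet a b c d) d| := by
  have hE := exp_neg_sq_le hr
  have e8 := exp_neg_nat_mul 8 r
  have e72 := exp_neg_nat_mul 72 r
  have hE0 := Real.exp_pos (-r ^ 2)
  have hne : ∃ x, gap a b c d x ≠ 0 := gap_ne_zero_of_tv_pos (by linarith)
  have hphi : ∀ y, |y| ≤ 4 * r → Real.exp (-r ^ 2) ^ 90 ≤ phi y := fun y hy => by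
    have h1 : phi (4 * r) ≤ phi y := phi_le_phi (hy.trans (le_abs_self _))
    have h2 := exp_half_le_phi (4 * r)
    rw [show -(4 * r) ^ 2 / 2 = -((8 : ℕ) * r ^ 2) by push_cast; ring, e8] at h2
    set E := Real.exp (-r ^ 2)
    have h3 : E ^ 90 ≤ E ^ 9 := pow_le_pow_of_le_one hE0.le (by linarith) (by norm_num)
    have h4 : E ^ 9 = E ^ 8 * E := by ring
    have h5 : 0 < E ^ 8 := by positivity
    nlinarith
  have htail : Real.exp (-(10 * r - 2 * r) ^ 2 / 8) = Real.exp (-r ^ 2) ^ 8 := by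
    rw [← e8]; congr 1; push_cast; ring
  -- The worst case, with `R = 10 * r`, `M = 2 * r`, `l = E / 8` and `s = E ^ 8`: here `phi (12 *
  -- r)` is at least `E ^ 72 / 3`, so the product is at least `E ^ 81 / 96`.
  have hnest : phi (10 * r + 2 * r) * (Real.exp (-r ^ 2) / 8 * Real.exp (-r ^ 2) ^ 8) / 4
      ≥ Real.exp (-r ^ 2) ^ 90 := by
    have h2 := exp_half_le_phi (10 * r + 2 * r)
    rw [show -(10 * r + 2 * r) ^ 2 / 2 = -((72 : ℕ) * r ^ 2) by push_cast; ring, e72] at h2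
    set E := Real.exp (-r ^ 2)
    calc E ^ 90 = E ^ 81 * (E * E * E ^ 7) := by ring
      _ ≤ E ^ 81 * (1 / 100 * (1 / 100) * 1) := by
        gcongr
        · linarith
        · linarith
        · exact pow_le_one₀ hE0.le (by linarith)
      _ ≤ E ^ 72 / 3 * (E / 8 * E ^ 8) / 4 := by
        have : 0 < E ^ 81 := by positivity
        have e : E ^ 72 / 3 * (E / 8 * E ^ 8) / 4 = E ^ 81 / 96 := by ring
        rw [e]; linarith
      _ ≤ _ := by gcongr
  have hsmall : 2 * (Real.exp (-r ^ 2) / 8) + 6 * Real.exp (-(10 * r - 2 * r) ^ 2 / 8)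
      < tv a b c d := by
    rw [htail]
    refine lt_of_lt_of_le ?_ htv
    set E := Real.exp (-r ^ 2)
    have h1 : E ^ 8 ≤ E ^ 2 := pow_le_pow_of_le_one hE0.le (by linarith) (by norm_num)
    nlinarith
  have hls : Real.exp (-r ^ 2) / 8 * Real.exp (-r ^ 2) ^ 8 ≤ 2 := by
    set E := Real.exp (-r ^ 2)
    have h1 : E ^ 8 ≤ 1 := pow_le_one₀ hE0.le (by linarith)
    nlinarith
  have hmm : Real.exp (-r ^ 2) ^ 8 ≤ |c - d| := by
    rw [abs_sub_comm]; exact hs.trans (le_abs_self _)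
  rcases le_total a c with hac | hca
  · rcases le_total b d with hbd | hdb
    · right
      have h1 := gder_posSet_le hab hcd hac hbd hne
      have h2 := hphi (a - d) ((abs_sub _ _).trans (by linarith))
      rw [abs_of_nonpos (by linarith [phi_pos (a - d)])]
      linarith
    -- Nesting must be strict for `ordConnected_posSet`; a shared extreme mean counts as a shifted
    -- configuration.
    · rcases hac.eq_or_lt with rfl | hac
      · left
        have h1 := le_gder_posSet hab hcd le_rfl hdb hne
        have h2 := hphi (b - a) ((abs_sub _ _).trans (by linarith))
        exact (h2.trans h1).trans (le_abs_self _)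
      rcases hdb.eq_or_lt with rfl | hdb
      · right
        have h1 := gder_posSet_le hab hcd hac.le le_rfl hne
        have h2 := hphi (a - d) ((abs_sub _ _).trans (by linarith))
        rw [abs_of_nonpos (by linarith [phi_pos (a - d)])]
        linarith
      have h := le_abs_gder_posSet_nested (ordConnected_posSet hac hcd hdb) hc hd ha hb
        (by linarith : 2 * r ≤ 10 * r) (by positivity) (by rwa [tv_swap]) (by positivity) hls hc hd
        hmm
      simp only [gder_posSet_swap hne, abs_neg] at h
      exact h.imp hnest.le.trans hnest.le.trans
  · rcases le_total d b with hdb | hbd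
    · left
      have h1 := le_gder_posSet hab hcd hca hdb hne
      have h2 := hphi (b - c) ((abs_sub _ _).trans (by linarith))
      exact (h2.trans h1).trans (le_abs_self _)
    · rcases hca.eq_or_lt with rfl | hca
      · right
        have h1 := gder_posSet_le hab hcd le_rfl hbd hne
        have h2 := hphi (c - d) ((abs_sub _ _).trans (by linarith))
        rw [abs_of_nonpos (by linarith [phi_pos (c - d)])]
        linarith
      rcases hbd.eq_or_lt with rfl | hbd
      · left
        have h1 := le_gder_posSet hab hcd hca.le le_rfl hne
        have h2 := hphi (b - c) ((abs_sub _ _).trans (by linarith))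
        exact (h2.trans h1).trans (le_abs_self _)
      have h := le_abs_gder_posSet_nested (ordConnected_posSet hca hab hbd) ha hb hc hd
        (by linarith : 2 * r ≤ 10 * r) (by positivity) hsmall (by positivity) hls hc hd hmm
      exact h.imp hnest.le.trans hnest.le.trans

/-! ### Means far out are not pushed further -/

lemma gap_neg_of_far {r a b c d x : ℝ} (ha : |a| ≤ r) (hb : |b| ≤ r) (hd : r + 2 ≤ d)
    (hx : d ≤ x) : gap a b c d x < 0 := by
  have ha' := abs_le.mp ha
  have hb' := abs_le.mp hb
  have h1 : ∀ m : ℝ, m ≤ r → phi (x - m) ≤ phi (x - r) := fun m hm => phi_le_phi (by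
    rw [abs_of_nonneg (by linarith), abs_of_nonneg (by linarith)]; linarith)
  -- The truth has density at most `phi (x - r) ≤ exp (-2) * phi (x - d)`, whereas the component at
  -- `d` alone gives the generator `phi (x - d) / 2`.
  have e : phi (x - r) = phi (x - d) * Real.exp (-((d - r) * (2 * x - r - d) / 2)) := by
    unfold phi
    rw [mul_assoc, ← Real.exp_add]; congr 2; ring
  have h2 : Real.exp (-((d - r) * (2 * x - r - d) / 2)) ≤ Real.exp (-2) := by
    gcongr; nlinarith
  have h3 : Real.exp (-2) < 1 / 2 := by
    have h4 := Real.add_one_le_exp (2 : ℝ)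
    have h5 : Real.exp (-2) * Real.exp 2 = 1 := by rw [← Real.exp_add]; simp
    have := Real.exp_pos (-2)
    nlinarith
  have h6 := h1 a ha'.2
  have h7 := h1 b hb'.2
  have h8 := phi_pos (x - c)
  have h9 := phi_pos (x - d)
  rw [e] at h6 h7
  have h10 : phi (x - d) * Real.exp (-((d - r) * (2 * x - r - d) / 2)) ≤ phi (x - d) * (1 / 2) := by
    gcongr; linarith
  unfold gap den
  linarith

lemma gder_nonpos_of_far {r a b c d : ℝ} (ha : |a| ≤ r) (hb : |b| ≤ r) (hd : r + 2 ≤ d) :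
    gder (posSet a b c d) d ≤ 0 := by
  refine gder_nonpos_of_subset (measurableSet_posSet a b c d) fun x hx => ?_
  by_contra h
  exact lt_asymm hx (gap_neg_of_far ha hb hd (not_le.mp h).le)

lemma gder_nonneg_of_far {r a b c d : ℝ} (ha : |a| ≤ r) (hb : |b| ≤ r) (hd : d ≤ -(r + 2)) :
    0 ≤ gder (posSet a b c d) d := by
  have := gder_nonpos_of_far (r := r) (a := -a) (b := -b) (c := -c) (d := -d) (by rwa [abs_neg])
    (by rwa [abs_neg]) (by linarith)
  rw [gder_posSet_neg] at this
  linarith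

/-! ### Nearly equal generator means are not drawn together -/

lemma exists_slopes {f f' : ℝ → ℝ} (hf : ∀ x, HasDerivAt f (f' x) x) {t u : ℝ} (ht : 0 < t)
    (htu : t ≤ u) (h0 : f 0 < 0) (h1 : 0 < f t) (h2 : f u ≤ 0) :
    ∃ ξ ζ, 0 < ξ ∧ ξ < ζ ∧ 0 < f' ξ ∧ f' ζ < 0 := by
  have htu' : t < u := lt_of_le_of_ne htu (by rintro rfl; linarith)
  have hcont : ∀ s, ContinuousOn f s := fun s x _ => (hf x).continuousAt.continuousWithinAt
  obtain ⟨ξ, hξ, e1⟩ := exists_hasDerivAt_eq_slope f f' ht (hcont _) (fun x _ => hf x)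
  obtain ⟨ζ, hζ, e2⟩ := exists_hasDerivAt_eq_slope f f' htu' (hcont _) (fun x _ => hf x)
  refine ⟨ξ, ζ, hξ.1, hξ.2.trans hζ.1, ?_, ?_⟩
  · rw [e1]; exact div_pos (by linarith) (by linarith)
  · rw [e2]; exact div_neg_of_neg_of_pos (by linarith) (by linarith)

lemma exp_neg_le_one_sub_half {t : ℝ} (h0 : 0 ≤ t) (h1 : t ≤ 1) : Real.exp (-t) ≤ 1 - t / 2 := by
  have h2 : Real.exp (-t) * Real.exp t = 1 := by rw [← Real.exp_add]; simp
  have h3 := Real.add_one_le_exp t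
  have h4 := Real.exp_pos (-t)
  nlinarith

lemma hasDerivAt_const_mul_exp (A k x : ℝ) :
    HasDerivAt (fun x => A * Real.exp (k * x)) (A * k * Real.exp (k * x)) x :=
  ((((hasDerivAt_id x).const_mul k).exp).const_mul A).congr_deriv (by simp; ring)

/-- Twice the quotient by `phi t` of the difference of densities at distance `t` to the left of the
midpoint of the two means of the generator. -/
noncomputable def midGap (α β κ t : ℝ) : ℝ :=
  Real.exp (-α ^ 2 / 2) * Real.exp (α * t) + Real.exp (-β ^ 2 / 2) * Real.exp (β * t)
    - Real.exp (-κ ^ 2 / 2) * Real.exp (κ * t) - Real.exp (-κ ^ 2 / 2) * Real.exp (-κ * t)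

lemma gap_eq_midGap (a b c d t : ℝ) : gap a b c d ((c + d) / 2 - t)
    = phi t / 2 * midGap ((c + d) / 2 - a) ((c + d) / 2 - b) ((d - c) / 2) t := by
  have h : ∀ m k : ℝ, k = (c + d) / 2 - m → phi ((c + d) / 2 - t - m)
      = phi t * (Real.exp (-k ^ 2 / 2) * Real.exp (k * t)) := by
    intro m k hk
    rw [← Real.exp_add, ← phi_neg, show -((c + d) / 2 - t - m) = t - k by rw [hk]; ring,
      phi_eq_exp_mul]
    congr 2; ring
  have e : Real.exp (-(-((d - c) / 2)) ^ 2 / 2) = Real.exp (-((d - c) / 2) ^ 2 / 2) := by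
    rw [neg_sq]
  unfold gap den midGap
  rw [h a _ rfl, h b _ rfl, h c ((d - c) / 2) (by ring), h d (-((d - c) / 2)) (by ring), e]
  ring

/-- One mean of the truth is at distance at least `E / 2` from the midpoint, which costs `E ^ 2 /
16`; the two generator means are so close to it that they lose only `κ ^ 2`. -/
lemma midGap_zero_neg {α β κ E : ℝ} (hE0 : 0 < E) (hE : E * 100 ≤ 1) (hαβ : E ≤ α - β)
    (hκ0 : 0 < κ) (hκ : κ ≤ E ^ 8) : midGap α β κ 0 < 0 := by
  have hκ1 : κ ≤ E ^ 2 := hκ.trans (pow_le_pow_of_le_one hE0.le (by linarith) (by norm_num))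
  have hκ2 : κ ^ 2 < E ^ 2 / 16 := by
    have h1 : κ ≤ E / 100 := by nlinarith
    have h2 : κ ^ 2 ≤ (E / 100) ^ 2 := pow_le_pow_left₀ hκ0.le h1 2
    nlinarith
  have hle : ∀ x : ℝ, Real.exp (-x ^ 2 / 2) ≤ 1 := fun x =>
    Real.exp_le_one_iff.mpr (by nlinarith [sq_nonneg x])
  have hsm : ∀ x : ℝ, (E / 2) ^ 2 ≤ x ^ 2 → Real.exp (-x ^ 2 / 2) ≤ 1 - E ^ 2 / 16 := fun x hx => by
    have h1 : Real.exp (-x ^ 2 / 2) ≤ Real.exp (-(E ^ 2 / 8)) := by gcongr; linarith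
    have h2 := exp_neg_le_one_sub_half (t := E ^ 2 / 8) (by positivity) (by nlinarith)
    linarith
  have hK := Real.add_one_le_exp (-κ ^ 2 / 2)
  simp only [midGap, mul_zero, Real.exp_zero, mul_one]
  by_cases hα : E / 2 ≤ α
  · have h1 := hsm α (by nlinarith)
    have h2 := hle β
    linarith
  · have h1 := hsm β (by nlinarith [not_le.mp hα])
    have h2 := hle α
    linarith

/-- For `t ≥ κ` the comparison is termwise, `α` with `κ` and `β` with `-κ`. For `t ≤ κ` the deficit
of the `β` term outweighs the errors of order `κ ^ 2`. -/
lemma midGap_nonpos {E α β κ t : ℝ} (hE0 : 0 < E) (hE : E * 100 ≤ 1) (hκ0 : 0 < κ)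
    (hκE : κ < E / 100) (hκα : α < κ) (hβ : β < -(E / 2)) (ht : 0 < t) : midGap α β κ t ≤ 0 := by
  have hmerge : ∀ k : ℝ, Real.exp (-k ^ 2 / 2) * Real.exp (k * t)
      = Real.exp (k * t - k ^ 2 / 2) := by
    intro k; rw [← Real.exp_add]; ring_nf
  have hm2 := hmerge (-κ)
  rw [neg_sq] at hm2
  unfold midGap
  rw [hmerge, hmerge, hmerge, hm2]
  rcases le_total κ t with hκt | htκ
  · have i1 : Real.exp (α * t - α ^ 2 / 2) ≤ Real.exp (κ * t - κ ^ 2 / 2) := by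
      apply Real.exp_le_exp.mpr
      nlinarith [mul_nonneg (sub_pos.mpr hκα).le (by linarith : 0 ≤ t - (κ + α) / 2)]
    have i2 : Real.exp (β * t - β ^ 2 / 2) ≤ Real.exp (-κ * t - κ ^ 2 / 2) := by
      apply Real.exp_le_exp.mpr
      nlinarith [mul_nonneg (by linarith : 0 ≤ -κ - β) (by linarith : 0 ≤ t - (β - κ) / 2)]
    linarith
  · have hκ2 : κ ^ 2 ≤ (E / 100) ^ 2 := pow_le_pow_left₀ hκ0.le hκE.le 2
    have hE2 : E ^ 2 ≤ 1 := pow_le_one₀ hE0.le (by linarith)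
    have hE2' : 0 < E ^ 2 := by positivity
    have i1 : Real.exp (α * t - α ^ 2 / 2) ≤ 1 + κ ^ 2 := by
      have ht2 : t ^ 2 ≤ κ ^ 2 := pow_le_pow_left₀ ht.le htκ 2
      have h1 : Real.exp (α * t - α ^ 2 / 2) ≤ Real.exp (κ ^ 2 / 2) := by
        apply Real.exp_le_exp.mpr; linarith [sq_nonneg (α - t)]
      have h2 := Real.exp_bound_div_one_sub_of_interval (x := κ ^ 2 / 2) (by positivity)
        (by linarith)
      have h3 : 1 / (1 - κ ^ 2 / 2) ≤ 1 + κ ^ 2 := by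
        rw [div_le_iff₀ (by linarith)]
        nlinarith [mul_nonneg (sq_nonneg κ) (by linarith : 0 ≤ 1 - κ ^ 2)]
      linarith
    have i2 : Real.exp (β * t - β ^ 2 / 2) ≤ 1 - E ^ 2 / 16 := by
      have h1 : Real.exp (β * t - β ^ 2 / 2) ≤ Real.exp (-(E ^ 2 / 8)) := by
        apply Real.exp_le_exp.mpr
        have h2 : (E / 2) ^ 2 ≤ (-β) ^ 2 := pow_le_pow_left₀ (by linarith) (by linarith) 2
        have h3 : β * t ≤ 0 := mul_nonpos_of_nonpos_of_nonneg (by linarith) ht.le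
        linarith [neg_sq β]
      have h2 := exp_neg_le_one_sub_half (t := E ^ 2 / 8) (by positivity) (by linarith)
      linarith
    have i3 := Real.add_one_le_exp (κ * t - κ ^ 2 / 2)
    have i4 := Real.add_one_le_exp (-κ * t - κ ^ 2 / 2)
    linarith

/-- Once positive, `midGap` stays positive. -/
lemma midGap_pos_of_le {r α β κ t u : ℝ} (hr : 10 ≤ r) (hα : α ≤ 4 * r)
    (hαβ : Real.exp (-r ^ 2) ≤ α - β) (hκ0 : 0 < κ) (hκ : κ ≤ Real.exp (-r ^ 2) ^ 8)
    (ht : 0 < t) (htu : t ≤ u) (h : 0 < midGap α β κ t) : 0 < midGap α β κ u := by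
  have hE := exp_neg_sq_le hr
  have hE0 := Real.exp_pos (-r ^ 2)
  have e8 := exp_neg_nat_mul 8 r
  have h0 := midGap_zero_neg hE0 hE hαβ hκ0 hκ
  by_contra hu
  rw [not_lt] at hu
  -- For `α` of size at least `E / 2`, `midGap` is convex on positive `t`: its `α` term dominates
  -- both generator terms after two differentiations. A rise from a negative value cannot then be
  -- followed by a fall.
  by_cases hα2 : Real.exp (-r ^ 2) / 2 ≤ α
  · have hA : Real.exp (-r ^ 2) ^ 8 ≤ Real.exp (-α ^ 2 / 2) := by
      rw [← e8]
      apply Real.exp_le_exp.mpr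
      have : α ^ 2 ≤ (4 * r) ^ 2 := pow_le_pow_left₀ (by linarith) hα 2
      push_cast; linarith
    set E := Real.exp (-r ^ 2)
    have hd1 : ∀ x, HasDerivAt (midGap α β κ) (Real.exp (-α ^ 2 / 2) * α * Real.exp (α * x)
        + Real.exp (-β ^ 2 / 2) * β * Real.exp (β * x)
        - Real.exp (-κ ^ 2 / 2) * κ * Real.exp (κ * x)
        - Real.exp (-κ ^ 2 / 2) * -κ * Real.exp (-κ * x)) x := fun x =>
      (((hasDerivAt_const_mul_exp _ α x).fun_add (hasDerivAt_const_mul_exp _ β x)).fun_sub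
        (hasDerivAt_const_mul_exp _ κ x)).fun_sub (hasDerivAt_const_mul_exp _ (-κ) x)
    have hd2 : ∀ x, HasDerivAt (fun x => Real.exp (-α ^ 2 / 2) * α * Real.exp (α * x)
        + Real.exp (-β ^ 2 / 2) * β * Real.exp (β * x)
        - Real.exp (-κ ^ 2 / 2) * κ * Real.exp (κ * x)
        - Real.exp (-κ ^ 2 / 2) * -κ * Real.exp (-κ * x))
        (Real.exp (-α ^ 2 / 2) * α * α * Real.exp (α * x)
        + Real.exp (-β ^ 2 / 2) * β * β * Real.exp (β * x)
        - Real.exp (-κ ^ 2 / 2) * κ * κ * Real.exp (κ * x)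
        - Real.exp (-κ ^ 2 / 2) * -κ * -κ * Real.exp (-κ * x)) x := fun x =>
      (((hasDerivAt_const_mul_exp _ α x).fun_add (hasDerivAt_const_mul_exp _ β x)).fun_sub
        (hasDerivAt_const_mul_exp _ κ x)).fun_sub (hasDerivAt_const_mul_exp _ (-κ) x)
    obtain ⟨ξ, ζ, hξ0, hξζ, hξ, hζ⟩ := exists_slopes hd1 ht htu h0 h hu
    obtain ⟨θ, hθ, e⟩ := exists_hasDerivAt_eq_slope _ _ hξζ
      (fun x _ => (hd2 x).continuousAt.continuousWithinAt) (fun x _ => hd2 x)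
    have hneg : Real.exp (-α ^ 2 / 2) * α * α * Real.exp (α * θ)
        + Real.exp (-β ^ 2 / 2) * β * β * Real.exp (β * θ)
        - Real.exp (-κ ^ 2 / 2) * κ * κ * Real.exp (κ * θ)
        - Real.exp (-κ ^ 2 / 2) * -κ * -κ * Real.exp (-κ * θ) < 0 := by
      rw [e]; exact div_neg_of_neg_of_pos (by linarith) (by linarith)
    have hθ0 : 0 < θ := hξ0.trans hθ.1
    have hκα : κ ≤ α := by
      have : E ^ 8 ≤ E ^ 2 := pow_le_pow_of_le_one hE0.le (by linarith) (by norm_num)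
      nlinarith
    have i1 : Real.exp (κ * θ) ≤ Real.exp (α * θ) := by gcongr
    have i2 : Real.exp (-κ * θ) ≤ Real.exp (κ * θ) := by gcongr; linarith
    have i3 : Real.exp (-κ ^ 2 / 2) ≤ 1 := Real.exp_le_one_iff.mpr (by nlinarith [sq_nonneg κ])
    have i4 : 2 * κ ^ 2 ≤ Real.exp (-α ^ 2 / 2) * α ^ 2 := by
      have h1 : κ ^ 2 ≤ (E ^ 8) ^ 2 := pow_le_pow_left₀ hκ0.le hκ 2
      have h2 : E ^ 8 * (E / 2) ^ 2 ≤ Real.exp (-α ^ 2 / 2) * α ^ 2 := by gcongr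
      have h3 : (E ^ 8) ^ 2 = E ^ 10 * E * E ^ 5 := by ring
      have h4 : E ^ 8 * (E / 2) ^ 2 = E ^ 10 / 4 := by ring
      have h5 : E ^ 5 ≤ 1 := pow_le_one₀ hE0.le (by linarith)
      have h6 : E ^ 10 * E * E ^ 5 ≤ E ^ 10 * (1 / 100) * 1 := by gcongr; linarith
      have : 0 < E ^ 10 := by positivity
      linarith
    have i5 : 0 ≤ Real.exp (-β ^ 2 / 2) * β * β * Real.exp (β * θ) := by
      rw [mul_assoc (Real.exp _) β β]; have := mul_self_nonneg β; positivity
    have i6 : Real.exp (-κ ^ 2 / 2) * κ * κ * (Real.exp (κ * θ) + Real.exp (-κ * θ))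
        ≤ 1 * κ * κ * (Real.exp (κ * θ) + Real.exp (κ * θ)) := by gcongr
    have i7 : 2 * κ ^ 2 * Real.exp (κ * θ) ≤ Real.exp (-α ^ 2 / 2) * α ^ 2 * Real.exp (α * θ) :=
      mul_le_mul i4 i1 (Real.exp_pos _).le (by positivity)
    nlinarith
  rw [not_le] at hα2
  have hκE : κ < Real.exp (-r ^ 2) / 100 := by
    set E := Real.exp (-r ^ 2)
    have : E ^ 8 ≤ E ^ 3 := pow_le_pow_of_le_one hE0.le (by linarith) (by norm_num)
    nlinarith [mul_pos hE0 hE0]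
  set E := Real.exp (-r ^ 2)
  have hβ : β < -κ := by linarith
  -- For `κ ≤ α < E / 2`, the factor `exp (-κ * t)` removes one generator term. The derivative of
  -- what remains, times `exp (2 * κ * t)`, is nondecreasing because `β + κ < 0`, so it cannot pass
  -- from positive to negative.
  by_cases hκα : κ ≤ α
  · have hd : ∀ x, HasDerivAt (fun x => Real.exp (-κ * x) * midGap α β κ x)
        (Real.exp (-α ^ 2 / 2) * (α - κ) * Real.exp ((α - κ) * x)
        + Real.exp (-β ^ 2 / 2) * (β - κ) * Real.exp ((β - κ) * x)
        - Real.exp (-κ ^ 2 / 2) * (-2 * κ) * Real.exp ((-2 * κ) * x)) x := by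
      intro x
      have e : (fun x => Real.exp (-κ * x) * midGap α β κ x) = fun x =>
          Real.exp (-α ^ 2 / 2) * Real.exp ((α - κ) * x)
          + Real.exp (-β ^ 2 / 2) * Real.exp ((β - κ) * x) - Real.exp (-κ ^ 2 / 2)
          - Real.exp (-κ ^ 2 / 2) * Real.exp ((-2 * κ) * x) := by
        ext x
        have e1 : ∀ k : ℝ, Real.exp ((k - κ) * x) = Real.exp (-κ * x) * Real.exp (k * x) := by
          intro k; rw [← Real.exp_add]; ring_nf
        have e2 := e1 κ
        have e3 := e1 (-κ)
        rw [show -κ - κ = -2 * κ by ring] at e3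
        simp only [sub_self, zero_mul, Real.exp_zero] at e2
        rw [e1, e1, e3]
        unfold midGap
        linear_combination Real.exp (-κ ^ 2 / 2) * e2
      rw [e]
      exact (((hasDerivAt_const_mul_exp _ (α - κ) x).fun_add
        (hasDerivAt_const_mul_exp _ (β - κ) x)).sub_const _).fun_sub
        (hasDerivAt_const_mul_exp _ (-2 * κ) x)
    obtain ⟨ξ, ζ, hξ0, hξζ, hξ, hζ⟩ := exists_slopes hd ht htu
      (mul_neg_of_pos_of_neg (Real.exp_pos _) h0) (mul_pos (Real.exp_pos _) h)
      (mul_nonpos_of_nonneg_of_nonpos (Real.exp_pos _).le hu)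
    have e1 : ∀ k x : ℝ, Real.exp ((k - κ) * x) * Real.exp (2 * κ * x) = Real.exp ((k + κ) * x) := by
      intro k x; rw [← Real.exp_add]; ring_nf
    have e2 : ∀ x : ℝ, Real.exp (-2 * κ * x) * Real.exp (2 * κ * x) = 1 := by
      intro x; rw [← Real.exp_add]; ring_nf; simp
    have h1 := mul_pos hξ (Real.exp_pos (2 * κ * ξ))
    have h2 := mul_neg_of_neg_of_pos hζ (Real.exp_pos (2 * κ * ζ))
    simp only [sub_mul _ _ (Real.exp (2 * κ * _)), add_mul _ _ (Real.exp (2 * κ * _)), mul_assoc _ _ (Real.exp (2 * κ * _)), e1, e2]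
      at h1 h2
    have i1 : Real.exp ((α + κ) * ξ) ≤ Real.exp ((α + κ) * ζ) :=
      Real.exp_le_exp.mpr (mul_le_mul_of_nonneg_left hξζ.le (by linarith))
    have i2 : Real.exp ((β + κ) * ζ) ≤ Real.exp ((β + κ) * ξ) :=
      Real.exp_le_exp.mpr (mul_le_mul_of_nonpos_left hξζ.le (by linarith))
    have j1 := mul_le_mul_of_nonneg_left i1
      (mul_nonneg (Real.exp_pos (-α ^ 2 / 2)).le (sub_nonneg.mpr hκα))
    have j2 := mul_le_mul_of_nonneg_left i2
      (mul_nonneg (Real.exp_pos (-β ^ 2 / 2)).le (by linarith : 0 ≤ κ - β))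
    linarith
  · exact h.not_ge (midGap_nonpos hE0 hE hκ0 hκE (not_le.mp hκα) (by linarith) ht)

/-- `S` is a half-line ending left of the midpoint, so its endpoint is nearer to `c` than to `d` and
the leftward force on `c` is the stronger one. -/
lemma gder_le_gder_of_lower {S : Set ℝ} {c d : ℝ} (hcd : c ≤ d)
    (hS : ∀ x ∈ S, x ≤ (c + d) / 2) (hlow : ∀ x ∈ S, ∀ y, y ≤ x → y ∈ S) :
    gder S c ≤ gder S d := by
  rcases S.eq_empty_or_nonempty with rfl | hne
  · simp [gder]
  have hbdd : BddAbove S := ⟨_, hS⟩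
  have hz : sSup S ≤ (c + d) / 2 := csSup_le hne hS
  have hSe : S =ᵐ[volume] Set.Iic (sSup S) := by
    refine Filter.EventuallyLE.antisymm
      (Filter.Eventually.of_forall fun x hx => le_csSup hbdd hx) ?_
    refine (Iio_ae_eq_Iic (μ := volume) (a := sSup S)).symm.le.trans
      (Filter.Eventually.of_forall fun x hx => ?_)
    obtain ⟨y, hy, hyx⟩ := exists_lt_of_lt_csSup hne (show x < sSup S from hx)
    exact hlow y hy x hyx.le
  rw [gder_congr hSe, gder_congr hSe, gder_Iic, gder_Iic, neg_le_neg_iff]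
  refine phi_le_phi (sq_le_sq.mp ?_)
  nlinarith

lemma gder_lower_half_le {r a b c d : ℝ} (hr : 10 ≤ r) (hab : Real.exp (-r ^ 2) ≤ b - a)
    (ha : |a| ≤ 2 * r) (hd : |d| ≤ 2 * r) (hcd : c < d)
    (hs : d - c ≤ 2 * Real.exp (-r ^ 2) ^ 8) :
    gder (posSet a b c d ∩ Set.Iio ((c + d) / 2)) c
      ≤ gder (posSet a b c d ∩ Set.Iio ((c + d) / 2)) d := by
  rw [abs_le] at ha hd
  refine gder_le_gder_of_lower hcd.le (fun x hx => le_of_lt hx.2) fun x hx y hyx =>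
    ⟨?_, hyx.trans_lt hx.2⟩
  have h1 : 0 < gap a b c d x := hx.1
  have hx2 : x < (c + d) / 2 := hx.2
  change 0 < gap a b c d y
  have e : ∀ x, x = (c + d) / 2 - ((c + d) / 2 - x) := fun x => by ring
  rw [e x, gap_eq_midGap] at h1
  rw [e y, gap_eq_midGap]
  refine mul_pos (half_pos (phi_pos _)) ?_
  exact midGap_pos_of_le hr (by linarith) (by linarith) (by linarith) (by linarith) (by linarith)
    (by linarith) ((mul_pos_iff_of_pos_left (half_pos (phi_pos _))).mp h1)

/-- When the two means of the generator are close, the gradient step separates them. -/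
theorem gder_le_gder_of_close {r a b c d : ℝ} (hr : 10 ≤ r) (hab : Real.exp (-r ^ 2) ≤ b - a)
    (ha : |a| ≤ 2 * r) (hb : |b| ≤ 2 * r) (hc : |c| ≤ 2 * r) (hd : |d| ≤ 2 * r) (hcd : c < d)
    (hs : d - c ≤ 2 * Real.exp (-r ^ 2) ^ 8) :
    gder (posSet a b c d) c ≤ gder (posSet a b c d) d := by
  set S := posSet a b c d with hS
  have hSm : MeasurableSet S := measurableSet_posSet a b c d
  set n := (c + d) / 2 with hn
  have hSe : (S ∩ Set.Iio n ∪ S ∩ Set.Ioi n : Set ℝ) =ᵐ[volume] S := by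
    have h0 : ∀ᵐ x : ℝ, x ≠ n := by rw [ae_iff]; simp
    filter_upwards [h0] with x hx
    apply propext
    change (x ∈ S ∧ x < n ∨ x ∈ S ∧ n < x) ↔ x ∈ S
    grind
  have hadd : ∀ m, gder S m = gder (S ∩ Set.Iio n) m + gder (S ∩ Set.Ioi n) m := fun m => by
    rw [← gder_congr hSe]
    refine gder_union (Set.disjoint_left.mpr fun x hx hx' => ?_) (hSm.inter measurableSet_Ioi) m
    exact lt_asymm (show x < n from hx.2) hx'.2
  have h1 := gder_lower_half_le hr hab ha hd hcd hs
  -- The part of `posSet` right of the midpoint is handled by reflection.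
  have h2 := gder_lower_half_le (a := -b) (b := -a) (c := -d) (d := -c) hr (by linarith)
    (by rwa [abs_neg]) (by rwa [abs_neg]) (by linarith) (by linarith)
  have e : posSet (-b) (-a) (-d) (-c) ∩ Set.Iio ((-d + -c) / 2) = Neg.neg ⁻¹' (S ∩ Set.Ioi n) := by
    rw [posSet_comm_left, posSet_comm_right, posSet_neg, Set.preimage_inter]
    congr 1
    ext x
    simp only [Set.mem_Iio, Set.mem_preimage, Set.mem_Ioi, hn]
    constructor <;> intro h <;> linarith
  rw [e, gder_neg, gder_neg] at h2
  rw [hadd c, hadd d]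
  linarith

/-- Certifies that a generator with nearly equal means differs from the separated truth, so its
optimal set is determined almost everywhere. -/
lemma gap_midpoint_neg {r a b c d : ℝ} (hr : 10 ≤ r) (hab : Real.exp (-r ^ 2) ≤ b - a) (hcd : c < d)
    (hs : d - c ≤ 2 * Real.exp (-r ^ 2) ^ 8) : gap a b c d ((c + d) / 2) < 0 := by
  have h := midGap_zero_neg (α := (c + d) / 2 - a) (β := (c + d) / 2 - b) (κ := (d - c) / 2)
    (Real.exp_pos _) (exp_neg_sq_le hr) (by linarith) (by linarith) (by linarith)
  have e := gap_eq_midGap a b c d 0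
  rw [sub_zero] at e
  rw [e]
  exact mul_neg_of_pos_of_neg (half_pos (phi_pos _)) h

/-! ### Stability of the positive set -/

lemma mul_exp_neg_sq_le {r : ℝ} (hr : 10 ≤ r) : r * Real.exp (-r ^ 2) ≤ 1 := by
  have h1 := Real.add_one_le_exp (r ^ 2)
  have h2 : Real.exp (-r ^ 2) * Real.exp (r ^ 2) = 1 := by rw [← Real.exp_add]; simp
  have := Real.exp_pos (-r ^ 2)
  nlinarith

lemma tv_le_of_abs_gap_le {a b c d M R K : ℝ} (ha : |a| ≤ M) (hb : |b| ≤ M) (hMR : M ≤ R)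
    (hM : 0 ≤ M) (hK : 0 ≤ K) (h : ∀ y, |y| ≤ R → |gap a b c d y| ≤ K) :
    tv a b c d ≤ K * (2 * R) + 6 * Real.exp (-(R - M) ^ 2 / 8) := by
  have h1 := tv_le_inside_add_tail (c := c) (d := d) ha hb hMR
  have hvol : volume (posSet a b c d ∩ Set.Icc (-R) R) ≤ ENNReal.ofReal (2 * R) := by
    refine (measure_mono Set.inter_subset_right).trans_eq ?_
    rw [Real.volume_Icc]; congr 1; ring
  have h2 := setIntegral_inside_le (u := gap a b c d) (by linarith) hK hvol
    (fun x hx => h x (abs_le.mpr hx.2))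
  have h3 := le_abs_self (∫ x in posSet a b c d ∩ Set.Icc (-R) R, gap a b c d x)
  linarith

lemma volume_sublevel_gap_le {r a b c d h : ℝ} (hr : 10 ≤ r) (ha : |a| ≤ 2 * r) (hb : |b| ≤ 2 * r)
    (hc : |c| ≤ 2 * r) (hd : |d| ≤ 2 * r) (htv : Real.exp (-r ^ 2) / 2 ≤ tv a b c d)
    (hh0 : 0 ≤ h) (hh : h ≤ Real.exp (-r ^ 2) ^ 4000) :
    volume ({x | |gap a b c d x| ≤ h} ∩ Set.Icc (-(42 * r)) (42 * r))
      ≤ ENNReal.ofReal (16 * Real.exp (-r ^ 2) ^ 182) := by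
  have hE := exp_neg_sq_le hr
  have hrE := mul_exp_neg_sq_le hr
  have e200 := exp_neg_nat_mul 200 r
  have e882 := exp_neg_nat_mul 882 r
  have e2520 := exp_neg_nat_mul 2520 r
  have hE0 := Real.exp_pos (-r ^ 2)
  rcases volume_sublevel_gap_le_or (M := 2 * r) (R := 42 * r) (s := Real.exp (-r ^ 2) ^ 182)
    (by linarith) (by positivity) (pow_le_one₀ hE0.le (by linarith)) hh0 ha hb hc hd with h1 | h1
  · exact h1
  exfalso
  set K := Real.exp (30 * (2 * r * (42 * r))) * (5 * (42 * r) / Real.exp (-r ^ 2) ^ 182) ^ 3 *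
    (3 * Real.exp ((42 * r) ^ 2 / 2) * h) with hK
  have hK0 : 0 ≤ K := by positivity
  have h2 := tv_le_of_abs_gap_le ha hb (by linarith : 2 * r ≤ 42 * r) (by linarith) hK0 h1
  rw [show -(42 * r - 2 * r) ^ 2 / 8 = -((200 : ℕ) * r ^ 2) by push_cast; ring, e200] at h2
  have i1 : Real.exp (30 * (2 * r * (42 * r))) * Real.exp (-r ^ 2) ^ 2520 = 1 := by
    rw [← e2520, ← Real.exp_add]; push_cast; ring_nf; simp
  have i2 : Real.exp ((42 * r) ^ 2 / 2) * Real.exp (-r ^ 2) ^ 882 = 1 := by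
    rw [← e882, ← Real.exp_add]; push_cast; ring_nf; simp
  set E := Real.exp (-r ^ 2)
  set X := Real.exp (30 * (2 * r * (42 * r)))
  set Y := Real.exp ((42 * r) ^ 2 / 2)
  -- Of the 4000 powers of `E` in `h`, the Remez constant uses `2520 + 3 * 182`, the division by
  -- `phi` uses 882, and numerical factors and powers of `r` use 9. The rest makes the distance far
  -- smaller than `E / 2`.
  have hKE : K * (2 * (42 * r)) ≤ E ^ 43 := by
    have i3 : K * (2 * (42 * r)) ≤ X * (5 * (42 * r) / E ^ 182) ^ 3 * (3 * Y * E ^ 4000)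
        * (2 * (42 * r)) := by rw [hK]; gcongr
    have i4 : X * (5 * (42 * r) / E ^ 182) ^ 3 * (3 * Y * E ^ 4000) * (2 * (42 * r))
        = (X * E ^ 2520) * (Y * E ^ 882) * (210 ^ 3 * 252 * E ^ 5) * (r * E) ^ 4 * E ^ 43 := by
      have : E ^ 182 ≠ 0 := by positivity
      rw [div_pow, mul_div_assoc', div_mul_eq_mul_div, div_mul_eq_mul_div, div_eq_iff (by positivity)]
      ring
    have i5 : (210 : ℝ) ^ 3 * 252 * E ^ 5 ≤ 1 := by
      have : E ^ 5 ≤ (1 / 100) ^ 5 := pow_le_pow_left₀ hE0.le (by linarith) 5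
      calc (210 : ℝ) ^ 3 * 252 * E ^ 5 ≤ 210 ^ 3 * 252 * (1 / 100) ^ 5 := by gcongr
        _ ≤ 1 := by norm_num
    have i6 : (r * E) ^ 4 ≤ 1 := pow_le_one₀ (by positivity) hrE
    rw [i4, i1, i2] at i3
    calc _ ≤ _ := i3
      _ ≤ 1 * 1 * 1 * 1 * E ^ 43 := by gcongr
      _ = E ^ 43 := by ring
  have j1 : E ^ 43 ≤ E ^ 2 := pow_le_pow_of_le_one hE0.le (by linarith) (by norm_num)
  have j2 : E ^ 200 ≤ E ^ 2 := pow_le_pow_of_le_one hE0.le (by linarith) (by norm_num)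
  nlinarith

lemma abs_gder_le_of_volume {A : Set ℝ} (hA : MeasurableSet A) {m M R v : ℝ} (hm : |m| ≤ M)
    (hMR : M ≤ R) (hv : 0 ≤ v) (hAv : volume (A ∩ Set.Icc (-R) R) ≤ ENNReal.ofReal v) :
    |gder A m| ≤ v + 6 * Real.exp (-(R - M) ^ 2 / 8) := by
  have e := integral_inter_add_sdiff (measurableSet_Icc (a := -R) (b := R))
    (integrable_psi m).integrableOn (s := A)
  have h1 := setIntegral_inside_le (u := fun x => psi (x - m)) hv zero_le_one hAv
    (fun x _ => abs_psi_le_one _)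
  have h2 := abs_setIntegral_le_tail (u := fun x => psi (x - m)) hm hMR
    (fun x => abs_psi_le_exp _) (hA.diff (measurableSet_Icc (a := -R) (b := R))) fun x hx => by
      by_contra h
      exact hx.2 (abs_le.mp (not_le.mp h).le)
  unfold gder
  rw [← e]
  refine (abs_add_le _ _).trans ?_
  linarith

lemma abs_den_sub_le {c d c' d' h : ℝ} (hc : |c' - c| ≤ h) (hd : |d' - d| ≤ h) (x : ℝ) :
    |den c d x - den c' d' x| ≤ h := by
  have h1 := abs_phi_sub_le (x - c) (x - c')
  have h2 := abs_phi_sub_le (x - d) (x - d')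
  rw [show x - c - (x - c') = c' - c by ring] at h1
  rw [show x - d - (x - d') = d' - d by ring] at h2
  have e : den c d x - den c' d' x
      = ((phi (x - c) - phi (x - c')) + (phi (x - d) - phi (x - d'))) / 2 := by unfold den; ring
  rw [e, abs_div, abs_two]
  have := abs_add_le (phi (x - c) - phi (x - c')) (phi (x - d) - phi (x - d'))
  linarith

/-- Stability of the optimal discriminator away from the optimum. -/
lemma abs_gder_posSet_sub_le {r a b c d c' d' h m : ℝ} (hr : 10 ≤ r) (ha : |a| ≤ 2 * r)
    (hb : |b| ≤ 2 * r) (hc : |c| ≤ 2 * r) (hd : |d| ≤ 2 * r) (hm : |m| ≤ 2 * r)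
    (htv : Real.exp (-r ^ 2) / 2 ≤ tv a b c d) (hh : h ≤ Real.exp (-r ^ 2) ^ 4000)
    (hc' : |c' - c| ≤ h) (hd' : |d' - d| ≤ h) :
    |gder (posSet a b c' d') m - gder (posSet a b c d) m| ≤ Real.exp (-r ^ 2) ^ 181 := by
  have hh0 : 0 ≤ h := (abs_nonneg _).trans hc'
  have hv := volume_sublevel_gap_le hr ha hb hc hd htv hh0 hh
  have hE := exp_neg_sq_le hr
  have hE0 := Real.exp_pos (-r ^ 2)
  have e200 := exp_neg_nat_mul 200 r
  set S := posSet a b c d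
  set S' := posSet a b c' d'
  have hS : MeasurableSet S := measurableSet_posSet a b c d
  have hS' : MeasurableSet S' := measurableSet_posSet a b c' d'
  have hgap : ∀ x, |gap a b c' d' x - gap a b c d x| ≤ h := fun x => by
    have := abs_den_sub_le hc' hd' x
    unfold gap
    rwa [show den a b x - den c' d' x - (den a b x - den c d x) = den c d x - den c' d' x by ring]
  -- The density moves by at most `h`, so the sign can change only where `gap` was at most `h` in
  -- size.
  have hsub1 : S' \ S ⊆ {x | |gap a b c d x| ≤ h} := by
    rintro x ⟨hx1, hx2⟩
    have h1 : 0 < gap a b c' d' x := hx1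
    have h2 : gap a b c d x ≤ 0 := not_lt.mp hx2
    have h3 := abs_le.mp (hgap x)
    change |gap a b c d x| ≤ h
    rw [abs_le]
    constructor <;> linarith [h3.1, h3.2]
  have hsub2 : S \ S' ⊆ {x | |gap a b c d x| ≤ h} := by
    rintro x ⟨hx1, hx2⟩
    have h1 : 0 < gap a b c d x := hx1
    have h2 : gap a b c' d' x ≤ 0 := not_lt.mp hx2
    have h3 := abs_le.mp (hgap x)
    change |gap a b c d x| ≤ h
    rw [abs_le]
    constructor <;> linarith [h3.1, h3.2]
  have key : ∀ A : Set ℝ, MeasurableSet A → A ⊆ {x | |gap a b c d x| ≤ h} →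
      |gder A m| ≤ 16 * Real.exp (-r ^ 2) ^ 182 + 6 * Real.exp (-r ^ 2) ^ 200 := fun A hA hAs => by
    have := abs_gder_le_of_volume hA hm (by linarith : 2 * r ≤ 42 * r)
      (v := 16 * Real.exp (-r ^ 2) ^ 182) (by positivity)
      ((measure_mono (Set.inter_subset_inter_left _ hAs)).trans hv)
    rwa [show -(42 * r - 2 * r) ^ 2 / 8 = -((200 : ℕ) * r ^ 2) by push_cast; ring, e200] at this
  have k1 := key _ (hS'.diff hS) hsub1
  have k2 := key _ (hS.diff hS') hsub2
  have e1 : gder S' m = gder (S' ∩ S) m + gder (S' \ S) m :=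
    (integral_inter_add_sdiff hS (integrable_psi m).integrableOn).symm
  have e2 : gder S m = gder (S' ∩ S) m + gder (S \ S') m := by
    rw [Set.inter_comm]
    exact (integral_inter_add_sdiff hS' (integrable_psi m).integrableOn).symm
  rw [e1, e2, add_sub_add_left_eq_sub]
  refine (abs_sub _ _).trans ?_
  set E := Real.exp (-r ^ 2)
  have j1 : E ^ 200 ≤ E ^ 182 := pow_le_pow_of_le_one hE0.le (by linarith) (by norm_num)
  have j2 : E ^ 182 = E ^ 181 * E := by ring
  have j3 : 0 < E ^ 181 := by positivity
  nlinarith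

/-! ### One step of the dynamics -/

lemma exists_le_abs_gder_of_sep {r a b c d : ℝ} (hr : 10 ≤ r)
    (ha : |a| ≤ 2 * r) (hb : |b| ≤ 2 * r) (hc : |c| ≤ 2 * r) (hd : |d| ≤ 2 * r)
    (hs : Real.exp (-r ^ 2) ^ 8 ≤ |c - d|) (htv : Real.exp (-r ^ 2) / 2 ≤ tv a b c d) :
    Real.exp (-r ^ 2) ^ 90 ≤ |gder (posSet a b c d) c| ∨
      Real.exp (-r ^ 2) ^ 90 ≤ |gder (posSet a b c d) d| := by
  wlog hab : a ≤ b generalizing a b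
  · have := this hb ha (by rwa [tv_comm_left]) (le_of_not_ge hab)
    rwa [posSet_comm_left] at this
  wlog hcd : c ≤ d generalizing c d
  · have := this hd hc (by rwa [abs_sub_comm]) (by rwa [tv_comm_right]) (le_of_not_ge hcd)
    rw [posSet_comm_right] at this
    exact this.symm
  exact exists_le_abs_gder hr hab hcd ha hb hc hd
    (by rwa [abs_sub_comm, abs_of_nonneg (by linarith)] at hs) htv

/-- The positive set of the new generator is a competitor for the old one, so the increase is at
most the change of mass on one fixed set. No differentiability of `tv` is needed, but the forces are
those of the new set, which is why stability matters. -/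
lemma tv_sub_tv_le (a b c d h₁ h₂ : ℝ) (hh₁ : |h₁| ≤ 1) (hh₂ : |h₂| ≤ 1) :
    tv a b (c + h₁) (d + h₂) - tv a b c d ≤
      (-(h₁ * gder (posSet a b (c + h₁) (d + h₂)) c) + 48 * h₁ ^ 2
        - h₂ * gder (posSet a b (c + h₁) (d + h₂)) d + 48 * h₂ ^ 2) / 2 := by
  set S := posSet a b (c + h₁) (d + h₂) with hS
  have h1 : ∫ x in S, gap a b c d x ≤ tv a b c d := setIntegral_gap_le_tv S a b c d
  have h2 : tv a b (c + h₁) (d + h₂) = ∫ x in S, gap a b (c + h₁) (d + h₂) x := rfl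
  rw [setIntegral_gap, setIntegral_den _ c] at h1
  rw [setIntegral_gap, setIntegral_den _ (c + h₁)] at h2
  have t1 := abs_le.mp (abs_gmass_taylor_le S c hh₁)
  have t2 := abs_le.mp (abs_gmass_taylor_le S d hh₂)
  linarith [t1.1, t2.1]

lemma tv_step_small {a b c d h₁ h₂ η : ℝ} (hη : η * 100 ≤ 1) (hh₁ : |h₁| ≤ 3 * η)
    (hh₂ : |h₂| ≤ 3 * η) : tv a b (c + h₁) (d + h₂) ≤ tv a b c d + 20 * η := by
  have h1 := tv_sub_tv_le a b c d h₁ h₂ (by linarith) (by linarith)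
  set S := posSet a b (c + h₁) (d + h₂)
  have hη0 : 0 ≤ η := by linarith [abs_nonneg h₁]
  have key : ∀ h m : ℝ, |h| ≤ 3 * η → -(h * gder S m) + 48 * h ^ 2 ≤ 20 * η := by
    intro h m hh
    have i1 : -(h * gder S m) ≤ 3 * η * 4 := by
      calc -(h * gder S m) ≤ |h * gder S m| := neg_le_abs _
        _ = |h| * |gder S m| := abs_mul _ _
        _ ≤ 3 * η * 4 := by gcongr; exact abs_gder_le S m
    have i2 : h ^ 2 ≤ (3 * η) ^ 2 := by rw [← sq_abs]; gcongr
    nlinarith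
  linarith [key h₁ c hh₁, key h₂ d hh₂]

/-- One coordinate of the descent: `γ` is the force of the old set, `g` that of the new one, `x` the
noise. Later `P`, `Q`, `Q'` are `E ^ 180`, `E ^ 181`, `E ^ 182`, and `P` is the square of the
gradient lower bound. -/
lemma neg_step_mul_add_sq_le {η τ P Q Q' γ x g : ℝ} (hη0 : 0 < η) (hP : 0 < P) (hQ : Q ≤ P / 100)
    (hQ' : Q' ≤ P / 10000) (hη : η ≤ Q') (hτ : τ ≤ η * Q') (hγ : |γ| ≤ 4) (hx : |x| ≤ τ)
    (hb : |η / 2 * γ + x| ≤ 3 * η) (hg : |g - γ| ≤ Q) :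
    -((η / 2 * γ + x) * g) + 48 * (η / 2 * γ + x) ^ 2 ≤ -(η / 2 * γ ^ 2) + η * (P / 10) := by
  have i1 : -((η / 2 * γ + x) * (g - γ)) ≤ 3 * η * (P / 100) := by
    calc _ ≤ |(η / 2 * γ + x) * (g - γ)| := neg_le_abs _
      _ = |η / 2 * γ + x| * |g - γ| := abs_mul _ _
      _ ≤ _ := mul_le_mul hb (hg.trans hQ) (abs_nonneg _) (by positivity)
  have i2 : -(x * γ) ≤ η * (P / 10000) * 4 := by
    calc _ ≤ |x * γ| := neg_le_abs _
      _ = |x| * |γ| := abs_mul _ _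
      _ ≤ _ := mul_le_mul ((hx.trans hτ).trans (mul_le_mul_of_nonneg_left hQ' hη0.le)) hγ
        (abs_nonneg _) (by positivity)
  have i3 : (η / 2 * γ + x) ^ 2 ≤ (3 * η) ^ 2 := by
    rw [← sq_abs]; exact pow_le_pow_left₀ (abs_nonneg _) hb 2
  have i4 : η * η ≤ η * (P / 10000) := mul_le_mul_of_nonneg_left (hη.trans hQ') hη0.le
  have e : -((η / 2 * γ + x) * g)
      = -((η / 2 * γ + x) * (g - γ)) - η / 2 * γ ^ 2 + -(x * γ) := by ring
  have p : 0 < η * P := by positivity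
  rw [e]
  linarith

/-- One step of the dynamics decreases the total variation distance away from the optimum. -/
lemma tv_step_decrease {r a b c d η τ x₁ x₂ : ℝ} (hr : 10 ≤ r)
    (ha : |a| ≤ 2 * r) (hb : |b| ≤ 2 * r) (hc : |c| ≤ 2 * r) (hd : |d| ≤ 2 * r)
    (hs : Real.exp (-r ^ 2) ^ 8 ≤ |c - d|) (htv : Real.exp (-r ^ 2) / 2 ≤ tv a b c d)
    (hη0 : 0 < η) (hη : η ≤ Real.exp (-r ^ 2) ^ 4001) (hτ : τ ≤ η * Real.exp (-r ^ 2) ^ 182)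
    (hx₁ : |x₁| ≤ τ) (hx₂ : |x₂| ≤ τ) :
    tv a b (c + (η / 2 * gder (posSet a b c d) c + x₁))
      (d + (η / 2 * gder (posSet a b c d) d + x₂)) ≤ tv a b c d - η * Real.exp (-r ^ 2) ^ 181 := by
  have hE := exp_neg_sq_le hr
  have hE0 := Real.exp_pos (-r ^ 2)
  have hG := exists_le_abs_gder_of_sep hr ha hb hc hd hs htv
  set γ₁ := gder (posSet a b c d) c with hγ₁
  set γ₂ := gder (posSet a b c d) d with hγ₂
  have hg₁ : |γ₁| ≤ 4 := abs_gder_le _ _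
  have hg₂ : |γ₂| ≤ 4 := abs_gder_le _ _
  have hE182 : Real.exp (-r ^ 2) ^ 182 ≤ 1 := pow_le_one₀ hE0.le (by linarith)
  have hη182 : η ≤ Real.exp (-r ^ 2) ^ 182 :=
    hη.trans (pow_le_pow_of_le_one hE0.le (by linarith) (by norm_num))
  have hτη : τ ≤ η := hτ.trans (mul_le_of_le_one_right hη0.le hE182)
  have hstep : ∀ γ x : ℝ, |γ| ≤ 4 → |x| ≤ τ → |η / 2 * γ + x| ≤ 3 * η := by
    intro γ x hγ hx
    have h1 : |η / 2 * γ| ≤ η / 2 * 4 := by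
      rw [abs_mul, abs_of_pos (half_pos hη0)]; gcongr
    have := abs_add_le (η / 2 * γ) x
    linarith
  set h₁ := η / 2 * γ₁ + x₁ with hh₁
  set h₂ := η / 2 * γ₂ + x₂ with hh₂
  have hb₁ : |h₁| ≤ 3 * η := hstep γ₁ x₁ hg₁ hx₁
  have hb₂ : |h₂| ≤ 3 * η := hstep γ₂ x₂ hg₂ hx₂
  -- A whole step stays within the scale on which the positive set is stable; this dictates the
  -- exponent 4001.
  have hη4000 : 3 * η ≤ Real.exp (-r ^ 2) ^ 4000 := by
    have e : Real.exp (-r ^ 2) ^ 4001 = Real.exp (-r ^ 2) ^ 4000 * Real.exp (-r ^ 2) := pow_succ _ _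
    have : 0 < Real.exp (-r ^ 2) ^ 4000 := by positivity
    nlinarith
  have h3η : 3 * η ≤ 1 := hη4000.trans (pow_le_one₀ hE0.le (by linarith))
  have hdesc := tv_sub_tv_le a b c d h₁ h₂ (by linarith) (by linarith)
  have herr : ∀ m, |m| ≤ 2 * r → |gder (posSet a b (c + h₁) (d + h₂)) m - gder (posSet a b c d) m|
      ≤ Real.exp (-r ^ 2) ^ 181 := fun m hm =>
    abs_gder_posSet_sub_le hr ha hb hc hd hm htv hη4000 (by simpa using hb₁) (by simpa using hb₂)
  have herr₁ := herr c hc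
  have herr₂ := herr d hd
  rw [← hγ₁] at herr₁
  rw [← hγ₂] at herr₂
  set E := Real.exp (-r ^ 2)
  have e181 : E ^ 181 = E ^ 180 * E := pow_succ _ _
  have e182 : E ^ 182 = E ^ 180 * E ^ 2 := by rw [← pow_add]
  have e180 : E ^ 180 = (E ^ 90) ^ 2 := by rw [← pow_mul]
  have p180 : 0 < E ^ 180 := by positivity
  have hE1 : E ≤ 1 / 100 := by linarith only [hE]
  have hE2 : E ^ 2 ≤ 1 / 10000 :=
    (pow_le_pow_left₀ hE0.le hE1 2).trans_eq (by norm_num)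
  have s181 : E ^ 181 ≤ E ^ 180 / 100 := by
    rw [e181, div_eq_mul_one_div]; exact mul_le_mul_of_nonneg_left hE1 p180.le
  have s182 : E ^ 182 ≤ E ^ 180 / 10000 := by
    rw [e182, div_eq_mul_one_div]; exact mul_le_mul_of_nonneg_left hE2 p180.le
  have k1 := neg_step_mul_add_sq_le hη0 p180 s181 s182 hη182 hτ hg₁ hx₁ hb₁ herr₁
  have k2 := neg_step_mul_add_sq_le hη0 p180 s181 s182 hη182 hτ hg₂ hx₂ hb₂ herr₂
  have hsum : η * E ^ 180 ≤ η * (γ₁ ^ 2 + γ₂ ^ 2) := by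
    have : E ^ 180 ≤ γ₁ ^ 2 + γ₂ ^ 2 := by
      rw [e180]
      rcases hG with h | h
      · have : (E ^ 90) ^ 2 ≤ γ₁ ^ 2 := by rw [← sq_abs γ₁]; gcongr
        linarith [sq_nonneg γ₂]
      · have : (E ^ 90) ^ 2 ≤ γ₂ ^ 2 := by rw [← sq_abs γ₂]; gcongr
        linarith [sq_nonneg γ₁]
    gcongr
  have i5 : η * E ^ 181 ≤ η * (E ^ 180 / 100) := mul_le_mul_of_nonneg_left s181 hη0.le
  have p : 0 < η * E ^ 180 := by positivity
  rw [← hh₁] at k1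
  rw [← hh₂] at k2
  linarith only [i5, p, hsum, k1, k2, hdesc]

/-- Below distance `2 * E ^ 8` the drift does not reduce the distance; above it, one step costs at
most `4 * η ≤ E ^ 8 / 2` and leaves `3 / 2 * E ^ 8`. Noise costs `2 * τ` in both cases. -/
lemma sep_step {r a b c d η τ x₁ x₂ : ℝ} {D : Set ℝ} (hr : 10 ≤ r)
    (hD : (∃ x, gap a b c d x ≠ 0) → D =ᵐ[volume] posSet a b c d)
    (ha : |a| ≤ 2 * r) (hb : |b| ≤ 2 * r) (hc : |c| ≤ 2 * r) (hd : |d| ≤ 2 * r)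
    (hab : Real.exp (-r ^ 2) ≤ |a - b|) (hcd : 0 < |c - d|)
    (hη0 : 0 < η) (hη : η * 8 ≤ Real.exp (-r ^ 2) ^ 8)
    (hx₁ : |x₁| ≤ τ) (hx₂ : |x₂| ≤ τ) :
    min |c - d| (3 / 2 * Real.exp (-r ^ 2) ^ 8) - 2 * τ ≤
      |(c + (η / 2 * gder D c + x₁)) - (d + (η / 2 * gder D d + x₂))| := by
  wlog hab' : a ≤ b generalizing a b
  · exact this (by rwa [gap_comm_left, posSet_comm_left]) hb ha (by rwa [abs_sub_comm])
      (le_of_not_ge hab')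
  wlog hcd' : c ≤ d generalizing c d x₁ x₂
  · have := this hd hc (by rwa [abs_sub_comm]) hx₂ hx₁ (by rwa [gap_comm_right, posSet_comm_right])
      (le_of_not_ge hcd')
    rwa [abs_sub_comm d c, abs_sub_comm (d + _)] at this
  rw [abs_sub_comm, abs_of_nonneg (by linarith)] at hab hcd
  rw [abs_sub_comm c d, abs_of_nonneg hcd.le, abs_sub_comm]
  refine le_trans ?_ (le_abs_self _)
  have y1 := abs_le.mp hx₁
  have y2 := abs_le.mp hx₂
  by_cases hs : d - c ≤ 2 * Real.exp (-r ^ 2) ^ 8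
  · have h1 := gder_le_gder_of_close hr hab ha hb hc hd (by linarith) hs
    rw [← gder_congr (hD ⟨_, (gap_midpoint_neg hr hab (by linarith) hs).ne⟩),
      ← gder_congr (hD ⟨_, (gap_midpoint_neg hr hab (by linarith) hs).ne⟩)] at h1
    have h2 := mul_le_mul_of_nonneg_left h1 (half_pos hη0).le
    linarith [min_le_left (d - c) (3 / 2 * Real.exp (-r ^ 2) ^ 8)]
  · have g1 := abs_le.mp (abs_gder_le D c)
    have g2 := abs_le.mp (abs_gder_le D d)
    have h1 := mul_le_mul_of_nonneg_left g1.2 (half_pos hη0).le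
    have h2 := mul_le_mul_of_nonneg_left g2.1 (half_pos hη0).le
    linarith [min_le_right (d - c) (3 / 2 * Real.exp (-r ^ 2) ^ 8), not_le.mp hs]

/-- Beyond `r + 2` the drift is not outward; elsewhere it is at most `2 * η ≤ 1`, so it cannot lead
beyond `r + 3`. -/
lemma abs_step_le {r a b c d η τ x : ℝ} {D : Set ℝ}
    (hD : (∃ x, gap a b c d x ≠ 0) → D =ᵐ[volume] posSet a b c d)
    (ha : |a| ≤ r) (hb : |b| ≤ r) (hη0 : 0 < η) (hη : η * 2 ≤ 1) (hx : |x| ≤ τ) :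
    |d + (η / 2 * gder D d + x)| ≤ max |d| (r + 3) + τ := by
  have y := abs_le.mp hx
  have g := abs_le.mp (abs_gder_le D d)
  have h1 := mul_le_mul_of_nonneg_left g.2 (half_pos hη0).le
  have h2 := mul_le_mul_of_nonneg_left g.1 (half_pos hη0).le
  have m1 := le_max_left |d| (r + 3)
  have m2 := le_max_right |d| (r + 3)
  have hd := abs_le.mp m1
  rw [abs_le]
  constructor
  · by_cases hfar : d ≤ -(r + 2)
    · have hne : ∃ x, gap a b c d x ≠ 0 := by
        have := gap_neg_of_far (r := r) (a := -a) (b := -b) (c := -c) (d := -d) (x := -d)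
          (by rwa [abs_neg]) (by rwa [abs_neg]) (by linarith) le_rfl
        rw [gap_neg] at this
        exact ⟨d, this.ne⟩
      have h3 := gder_nonneg_of_far (c := c) ha hb hfar
      rw [← gder_congr (hD hne)] at h3
      have := mul_nonneg (half_pos hη0).le h3
      linarith
    · linarith
  · by_cases hfar : r + 2 ≤ d
    · have hne : ∃ x, gap a b c d x ≠ 0 := ⟨d, (gap_neg_of_far ha hb hfar le_rfl).ne⟩
      have h3 := gder_nonpos_of_far (c := c) ha hb hfar
      rw [← gder_congr (hD hne)] at h3
      have := mul_nonpos_of_nonneg_of_nonpos (half_pos hη0).le h3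
      linarith
    · linarith

lemma tv_le_one (a b c d : ℝ) : tv a b c d ≤ 1 := by
  unfold tv
  calc _ ≤ ∫ x in posSet a b c d, den a b x :=
        setIntegral_mono (integrable_gap a b c d).integrableOn (integrable_den a b).integrableOn
          fun x => by have := den_pos c d x; simp only [gap]; linarith
    _ ≤ ∫ x, den a b x := setIntegral_le_integral (integrable_den a b)
        (ae_of_all _ fun x => (den_pos a b x).le)
    _ = 1 := integral_den a b

/-! ### Convergence with deterministic and Gaussian perturbations -/

/-- Convergence of the dynamics under small deterministic perturbations. -/
theorem tvDist_le_of_small_noise {r η τ : ℝ} {T : ℕ} {μs : Param} {ξ μ : ℕ → Param} (hr : 10 ≤ r)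
    (hη0 : 0 < η) (hη : η ≤ Real.exp (-r ^ 2) ^ 4001)
    (hτ : τ ≤ η * Real.exp (-r ^ 2) ^ 182) (hτT : τ * T ≤ Real.exp (-r ^ 2) ^ 8 / 4)
    (hT : 1 ≤ η * Real.exp (-r ^ 2) ^ 181 * T)
    (hξ : ∀ t < T, ∀ i, |ξ t i| ≤ τ) (hμs : BoundedSeparated r (Real.exp (-r ^ 2)) μs)
    (hμ0 : BoundedSeparated r (Real.exp (-r ^ 2)) (μ 0)) (hrun : IsOptDiscDynamics μs η ξ μ) :
    tvDist (mixture μs) (mixture (μ T)) ≤ Real.exp (-r ^ 2) := by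
  have hE := exp_neg_sq_le hr
  have hE0 := Real.exp_pos (-r ^ 2)
  rw [tvDist_mixture]
  have hstep : ∀ t, ∃ D : Set ℝ, ((∃ x, gap (μs 0) (μs 1) (μ t 0) (μ t 1) x ≠ 0) →
      D =ᵐ[volume] posSet (μs 0) (μs 1) (μ t 0) (μ t 1)) ∧
      ∀ i, μ (t + 1) i = μ t i + (η / 2 * gder D (μ t i) + ξ t i) := by
    intro t
    obtain ⟨d, hd, e⟩ := hrun t
    refine ⟨discSet d, fun hne => hd.ae_eq hne, fun i => ?_⟩
    rw [e, PiLp.add_apply, PiLp.sub_apply, PiLp.smul_apply, gradient_loss μs (μ t) hd.1, smul_eq_mul]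
    ring
  set E := Real.exp (-r ^ 2)
  have hτ0 : 0 ≤ τ := by
    rcases T.eq_zero_or_pos with rfl | hTpos
    · norm_num at hT
    · exact (abs_nonneg _).trans (hξ 0 hTpos 0)
  have hE8 : 0 < E ^ 8 := by positivity
  have hE8' : E ^ 8 ≤ E * (1 / 100) := by
    have : E ^ 8 ≤ E ^ 2 := pow_le_pow_of_le_one hE0.le (by linarith) (by norm_num)
    nlinarith
  have hη9 : η ≤ E ^ 8 * (1 / 100) := by
    have h1 : E ^ 4001 ≤ E ^ 9 := pow_le_pow_of_le_one hE0.le (by linarith) (by norm_num)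
    have h2 : E ^ 9 = E ^ 8 * E := pow_succ _ _
    nlinarith
  have hμs2 : ∀ i, |μs i| ≤ 2 * r := fun i => (hμs.1 i).trans (by linarith)
  have hτη : τ ≤ η := hτ.trans (mul_le_of_le_one_right hη0.le (pow_le_one₀ hE0.le (by linarith)))
  -- The three invariants support each other: boundedness and separation license the descent. `hτT`
  -- keeps the accumulated noise so small that the means stay within `2 * r` and at least `E ^ 8`
  -- apart.
  have inv : ∀ t ≤ T, (∀ i, |μ t i| ≤ r + 3 + τ * t) ∧
      3 / 2 * E ^ 8 - 2 * τ * t ≤ |μ t 0 - μ t 1| ∧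
      tv (μs 0) (μs 1) (μ t 0) (μ t 1) ≤ max E (1 - η * E ^ 181 * t) := by
    intro t
    induction t with
    | zero =>
      intro _
      refine ⟨fun i => ?_, ?_, ?_⟩
      · have := hμ0.1 i
        simp only [Nat.cast_zero, mul_zero]; linarith
      · have := hμ0.2
        simp only [Nat.cast_zero, mul_zero]; linarith
      · simpa using Or.inr (tv_le_one _ _ _ _)
    | succ t ih =>
      intro ht
      obtain ⟨hbd, hsep, htv⟩ := ih (by omega)
      obtain ⟨D, hD, hnext⟩ := hstep t
      have hx := hξ t (by omega)
      have hτt : τ * t ≤ E ^ 8 / 4 := by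
        refine le_trans ?_ hτT
        have : (t : ℝ) ≤ T := by exact_mod_cast (by omega : t ≤ T)
        gcongr
      have hbd2 : ∀ i, |μ t i| ≤ 2 * r := fun i => (hbd i).trans (by linarith)
      have hsep2 : E ^ 8 ≤ |μ t 0 - μ t 1| := le_trans (by linarith) hsep
      have hτt0 : 0 ≤ τ * t := by positivity
      refine ⟨fun i => ?_, ?_, ?_⟩
      · have h1 : |μ (t + 1) i| ≤ max |μ t i| (r + 3) + τ := by
          rw [hnext]
          fin_cases i
          · exact abs_step_le (c := μ t 1) (by rwa [gap_comm_right, posSet_comm_right])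
              (hμs.1 0) (hμs.1 1) hη0 (by linarith) (hx 0)
          · exact abs_step_le hD (hμs.1 0) (hμs.1 1) hη0 (by linarith) (hx 1)
        have h2 : max |μ t i| (r + 3) ≤ r + 3 + τ * t := max_le (hbd i) (by linarith)
        push_cast
        linarith
      · have h1 := sep_step hr hD (hμs2 0) (hμs2 1) (hbd2 0) (hbd2 1) hμs.2
          (lt_of_lt_of_le hE8 hsep2) hη0 (by linarith) (hx 0) (hx 1)
        rw [← hnext, ← hnext] at h1
        have h2 : 3 / 2 * E ^ 8 - 2 * τ * t ≤ min |μ t 0 - μ t 1| (3 / 2 * E ^ 8) :=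
          le_min hsep (by linarith)
        push_cast
        linarith
      -- Below `E / 2` no descent is claimed: a step gains at most `20 * η`, which is less than `E /
      -- 2`.
      · by_cases hbig : E / 2 ≤ tv (μs 0) (μs 1) (μ t 0) (μ t 1)
        · have hne := gap_ne_zero_of_tv_pos (lt_of_lt_of_le (by positivity) hbig)
          have h1 := tv_step_decrease hr (hμs2 0) (hμs2 1) (hbd2 0) (hbd2 1) hsep2 hbig hη0 hη hτ
            (hx 0) (hx 1)
          rw [← gder_congr (hD hne), ← gder_congr (hD hne), ← hnext, ← hnext] at h1
          have h2 : 0 < η * E ^ 181 := by positivity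
          push_cast
          rcases le_max_iff.mp htv with h3 | h3
          · exact le_max_of_le_left (by linarith)
          · exact le_max_of_le_right (by linarith)
        · have hs : ∀ i, |η / 2 * gder D (μ t i) + ξ t i| ≤ 3 * η := fun i => by
            have h1 : |η / 2 * gder D (μ t i)| ≤ η / 2 * 4 := by
              rw [abs_mul, abs_of_pos (half_pos hη0)]
              exact mul_le_mul_of_nonneg_left (abs_gder_le _ _) (half_pos hη0).le
            have := abs_add_le (η / 2 * gder D (μ t i)) (ξ t i)
            linarith [hx i]
          have h1 := tv_step_small (a := μs 0) (b := μs 1) (c := μ t 0) (d := μ t 1) (η := η)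
            (by linarith) (hs 0) (hs 1)
          rw [← hnext, ← hnext] at h1
          exact le_max_of_le_left (by linarith [not_le.mp hbig])
  have hfin := (inv T le_rfl).2.2
  rwa [max_eq_left (by linarith)] at hfin

lemma BoundedSeparated.mono {C r δ E : ℝ} {μ : Param} (h : BoundedSeparated C δ μ) (hC : C ≤ r)
    (hE : E ≤ δ) : BoundedSeparated r E μ :=
  ⟨fun i => (h.1 i).trans hC, hE.trans h.2⟩

lemma exists_noiseless_run (μs μ₀ : Param) (η : ℝ) :
    ∃ μ : ℕ → Param, μ 0 = μ₀ ∧ IsOptDiscDynamics μs η (fun _ => 0) μ := by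
  choose d hd using exists_isOptimalDiscriminator μs
  refine ⟨fun t => Nat.rec μ₀ (fun _ ν => ν - η • gradient (fun ν' => loss μs ν' (d ν)) ν) t, rfl,
    fun t => ⟨_, hd _, ?_⟩⟩
  simp

/-- A probability measure gives little mass to the complement of a large ball. -/
lemma exists_measure_norm_gt_le (ν : Measure Param) [IsProbabilityMeasure ν] {ε : ℝ≥0∞}
    (hε : 0 < ε) : ∃ K : ℝ, 0 < K ∧ ν {x | K < ‖x‖} ≤ ε := by
  have hanti : Antitone fun n : ℕ => {x : Param | (n : ℝ) < ‖x‖} := fun m n hmn x hx =>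
    show (m : ℝ) < ‖x‖ from lt_of_le_of_lt (Nat.cast_le.mpr hmn) (show (n : ℝ) < ‖x‖ from hx)
  have hlim := tendsto_measure_iInter_atTop (μ := ν)
    (fun n : ℕ => (measurableSet_lt measurable_const measurable_norm :
      MeasurableSet {x : Param | (n : ℝ) < ‖x‖}).nullMeasurableSet) hanti
    ⟨0, measure_ne_top _ _⟩
  have he : ⋂ n : ℕ, {x : Param | (n : ℝ) < ‖x‖} = ∅ := by
    ext x
    simp only [Set.mem_iInter, Set.mem_empty_iff_false, iff_false, not_forall]
    obtain ⟨n, hn⟩ := exists_nat_ge ‖x‖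
    exact ⟨n, not_lt.mpr hn⟩
  rw [he, measure_empty] at hlim
  obtain ⟨n, hn0, hn⟩ := ((Filter.eventually_gt_atTop 0).and (hlim.eventually_le_const hε)).exists
  exact ⟨n, by exact_mod_cast hn0, hn⟩

/-- With high probability all of the first `T` scaled Gaussian perturbations are small. -/
lemma exists_noise_level (T : ℕ) {τ p : ℝ} (hτ : 0 < τ) (hp : 0 < p) :
    ∃ σ₀ : ℝ, 0 < σ₀ ∧ ∀ σ : ℝ, 0 < σ → σ ≤ σ₀ → ∀ (Ω : Type*) [MeasurableSpace Ω]
      (P : Measure Ω) (Z : ℕ → Ω → Param),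
      (∀ t, HasLaw (Z t) (stdGaussian Param) P) →
      P {ω | ∃ t < T, τ < ‖σ • Z t ω‖} ≤ ENNReal.ofReal p := by
  obtain ⟨K, hK0, hK⟩ := exists_measure_norm_gt_le (stdGaussian Param)
    (ε := ENNReal.ofReal (p / (T + 1))) (by positivity)
  refine ⟨τ / K, by positivity, fun σ hσ hσK Ω _ P Z hZ => ?_⟩
  have hmeas : MeasurableSet {x : Param | K < ‖x‖} := measurableSet_lt measurable_const measurable_norm
  have hone : ∀ t, P {ω | τ < ‖σ • Z t ω‖} ≤ ENNReal.ofReal (p / (T + 1)) := by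
    intro t
    calc P {ω | τ < ‖σ • Z t ω‖} ≤ P (Z t ⁻¹' {x | K < ‖x‖}) := measure_mono fun ω hω => by
          have h1 : τ < ‖σ • Z t ω‖ := hω
          rw [norm_smul, Real.norm_eq_abs, abs_of_pos hσ] at h1
          have h2 : σ * ‖Z t ω‖ ≤ τ / K * ‖Z t ω‖ := by gcongr
          have h3 : τ < τ / K * ‖Z t ω‖ := lt_of_lt_of_le h1 h2
          rw [div_mul_eq_mul_div, lt_div_iff₀ hK0] at h3
          exact lt_of_mul_lt_mul_left h3 hτ.le
      _ = stdGaussian Param {x | K < ‖x‖} := by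
          rw [← (hZ t).map_eq, Measure.map_apply_of_aemeasurable (hZ t).aemeasurable hmeas]
      _ ≤ _ := hK
  calc P {ω | ∃ t < T, τ < ‖σ • Z t ω‖} ≤ P (⋃ t ∈ Finset.range T, {ω | τ < ‖σ • Z t ω‖}) :=
        measure_mono fun ω ⟨t, ht, h⟩ => Set.mem_biUnion (Finset.mem_coe.mpr (Finset.mem_range.mpr ht)) h
    _ ≤ ∑ t ∈ Finset.range T, P {ω | τ < ‖σ • Z t ω‖} := measure_biUnion_finset_le _ _
    _ ≤ ∑ _t ∈ Finset.range T, ENNReal.ofReal (p / (T + 1)) := Finset.sum_le_sum fun t _ => hone t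
    _ = ENNReal.ofReal (T * (p / (T + 1))) := by
        rw [Finset.sum_const, Finset.card_range, nsmul_eq_mul,
          ENNReal.ofReal_mul (Nat.cast_nonneg T), ENNReal.ofReal_natCast]
    _ ≤ ENNReal.ofReal p := by
        apply ENNReal.ofReal_le_ofReal
        rw [← mul_div_assoc, div_le_iff₀ (by positivity)]
        nlinarith

end GaussGAN

theorem mainTheorem1 :
    ∃ (δ₀ c A : ℝ) (a b : ℕ), 0 < δ₀ ∧ 0 < c ∧ 0 < A ∧
      ∀ (δ C : ℝ), 0 < δ → δ ≤ δ₀ → 0 < C →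
      ∀ η : ℝ, 0 < η → η ≤ c * (δ * Real.exp (-C ^ 2)) ^ a →
      ∀ T : ℕ, A * (Real.exp (C ^ 2) / δ) ^ b / η ≤ (T : ℝ) →
        -- the dynamics without noise, for every choice of optimal discriminators
        (∀ μs μ₀ : GaussGAN.Param,
          GaussGAN.BoundedSeparated C δ μs → GaussGAN.BoundedSeparated C δ μ₀ →
          (∃ μ : ℕ → GaussGAN.Param,
            μ 0 = μ₀ ∧ GaussGAN.IsOptDiscDynamics μs η (fun _ => 0) μ) ∧
          ∀ μ : ℕ → GaussGAN.Param,
            μ 0 = μ₀ → GaussGAN.IsOptDiscDynamics μs η (fun _ => 0) μ →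
            GaussGAN.tvDist (GaussGAN.mixture μs) (GaussGAN.mixture (μ T)) ≤ δ) ∧
        -- the dynamics with sufficiently small Gaussian noise
        (∀ p : ℝ, 0 < p → ∃ σ₀ : ℝ, 0 < σ₀ ∧ ∀ σ : ℝ, 0 < σ → σ ≤ σ₀ →
          ∀ μs μ₀ : GaussGAN.Param,
          GaussGAN.BoundedSeparated C δ μs → GaussGAN.BoundedSeparated C δ μ₀ →
          ∀ (Ω : Type*) [MeasurableSpace Ω] (P : Measure Ω) [IsProbabilityMeasure P]
            (Z : ℕ → Ω → GaussGAN.Param) (μ : ℕ → Ω → GaussGAN.Param),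
            iIndepFun Z P →
            (∀ t, HasLaw (Z t) (stdGaussian GaussGAN.Param) P) →
            (∀ᵐ ω ∂P, μ 0 ω = μ₀ ∧
              GaussGAN.IsOptDiscDynamics μs η (fun t => σ • Z t ω) (fun t => μ t ω)) →
            P {ω | δ < GaussGAN.tvDist (GaussGAN.mixture μs) (GaussGAN.mixture (μ T ω))}
              ≤ ENNReal.ofReal p) := by
  -- `exp (-100)` gives `r ≥ 10`; 4001 comes from the stability scale and 181 from the decrease per
  -- step.
  refine ⟨Real.exp (-100), 1, 1, 4001, 181, Real.exp_pos _, one_pos, one_pos, ?_⟩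
  intro δ C hδ hδ₀ hC η hη0 hη T hT
  -- Chosen so that `exp (-r ^ 2) = δ * exp (-C ^ 2)`: this number is at most `δ`, and `r` is at
  -- least `C`, so `r` replaces both parameters.
  set r := √(C ^ 2 + -Real.log δ) with hr
  have hlog : 100 ≤ -Real.log δ := by
    have := Real.log_le_log hδ hδ₀
    rw [Real.log_exp] at this; linarith
  have hr2 : r ^ 2 = C ^ 2 + -Real.log δ := Real.sq_sqrt (by positivity)
  have hr10 : 10 ≤ r := Real.le_sqrt_of_sq_le (by nlinarith)
  have hCr : C ≤ r := Real.le_sqrt_of_sq_le (by linarith)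
  have hE : Real.exp (-r ^ 2) = δ * Real.exp (-C ^ 2) := by
    rw [hr2, show -(C ^ 2 + -Real.log δ) = Real.log δ + -C ^ 2 by ring, Real.exp_add,
      Real.exp_log hδ]
  have hEδ : Real.exp (-r ^ 2) ≤ δ := by
    rw [hE]
    exact mul_le_of_le_one_right hδ.le (Real.exp_le_one_iff.mpr (by nlinarith))
  have hinv : Real.exp (C ^ 2) / δ = (Real.exp (-r ^ 2))⁻¹ := by
    rw [hE, mul_inv, ← Real.exp_neg, neg_neg]; ring
  rw [one_mul, ← hE] at hη
  rw [one_mul, hinv, inv_pow, div_le_iff₀ hη0, inv_le_iff_one_le_mul₀ (by positivity)] at hT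
  have hT1 : 1 ≤ η * Real.exp (-r ^ 2) ^ 181 * T := by linarith
  have hTpos : (0 : ℝ) < T := by
    by_contra h
    have h1 : (T : ℝ) = 0 := le_antisymm (not_lt.mp h) (Nat.cast_nonneg T)
    rw [h1] at hT1; norm_num at hT1
  constructor
  · intro μs μ₀ hμs hμ₀
    refine ⟨GaussGAN.exists_noiseless_run μs μ₀ η, fun μ h0 hrun => ?_⟩
    refine (GaussGAN.tvDist_le_of_small_noise (τ := 0) hr10 hη0 hη (by positivity)
      (by rw [zero_mul]; positivity) hT1 (by simp) (hμs.mono hCr hEδ) ?_ hrun).trans hEδ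
    rw [h0]
    exact hμ₀.mono hCr hEδ
  · intro p hp
    -- The first bound keeps noise below the drift in each descent step; the second limits its sum
    -- over `T` steps.
    set τ := min (η * Real.exp (-r ^ 2) ^ 182) (Real.exp (-r ^ 2) ^ 8 / 4 / T) with hτ
    have hτ0 : 0 < τ := lt_min (by positivity) (by positivity)
    obtain ⟨σ₀, hσ₀, hσ⟩ := GaussGAN.exists_noise_level T hτ0 hp
    refine ⟨σ₀, hσ₀, fun σ hσ0 hσσ μs μ₀ hμs hμ₀ Ω _ P _ Z μ _ hZ hrun => ?_⟩
    refine le_trans ?_ (hσ σ hσ0 hσσ Ω P Z hZ)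
    refine measure_mono_ae ?_
    filter_upwards [hrun] with ω hω hbad
    change ∃ t < T, τ < ‖σ • Z t ω‖
    by_contra! hsmall
    have hbad' : δ < GaussGAN.tvDist (GaussGAN.mixture μs) (GaussGAN.mixture (μ T ω)) := hbad
    refine hbad'.not_ge (le_trans ?_ hEδ)
    refine GaussGAN.tvDist_le_of_small_noise (τ := τ) (μ := fun t => μ t ω) hr10 hη0 hη
      (min_le_left _ _) ?_ hT1 (fun t ht i => ?_) (hμs.mono hCr hEδ) ?_ hω.2
    · exact (le_div_iff₀ hTpos).mp (min_le_right _ _)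
    · exact (PiLp.norm_apply_le (σ • Z t ω) i).trans (hsmall t ht)
    · simp only [hω.1]
      exact hμ₀.mono hCr hEδ
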